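/- **Setting.** Let $\mathcal G$ be a strongly connected digraph on $n$ nodes with adjacency matrix $(a_{ik})$, $a_{ik}=1$ if $(i,k)$ is an edge and $0$ otherwise. Let $\mathcal L$ be its in-degree Laplacian, $(\mathcal L e)_i=\sum_{k} a_{ki}(e_i-e_k)$ (so $\mathcal L\mathbf 1_n=0$). Let $a\in\mathbb R^n_{\ge 0}$ (clock drifts), $\sigma^*\in\mathbb R$, $T_2\ge T_1>0$, $\mu>0$, $h\in\mathbb R$, $\gamma>0$. The closed-loop HyNTP hybrid system $\mathcal H=(C,f,D,G)$ has the state $$x=(e,u,\eta,\tau^*,\hat a,\hat\tau,\tau)\in\mathcal X:=\mathbb R^n\times\mathbb R^n\times\mathbb R^n\times\mathbb R^n_{\ge0}\times\mathbb R^n\times\mathbb R^n\times[0,T_2],$$ flow set $C=\mathcal X$, jump set $D=\{x\in\mathcal X:\tau=0\}$, flow map $$f(x)=\big(a+u-\sigma^*\mathbf 1_n,\ h\eta-\mu(\hat\tau-\tau^*),\ h\eta,\ a,\ -\mu(\hat\tau-\tau^*),\ \hat a-(\hat\tau-\tau^*),\ -1\big)$$ and jump map $$G(x)=\big(e,\ -\gamma\mathcal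 L e-\hat a+\sigma^*\mathbf 1_n,\ -\gamma\mathcal Le,\ \tau^*,\ \hat a,\ \hat\tau,\ [T_1,T_2]\big).$$ The synchronization set is $$\mathcal A=\{x\in\mathcal X: e_i=e_k,\ \eta_i=0,\ \hat a_i=a_i,\ \hat\tau_i=\tau^*_i,\ u_i=\eta_i-\hat a_i+\sigma^*\ \ \forall i,k\}.$$ Let $\mathcal T\in\mathbb R^{n\times n}$ be nonsingular with first column $\tfrac1{\sqrt n}\mathbf 1_n$ and let $\bar{\mathcal L}\in\mathbb R^{(n-1)\times(n-1)}$ be such that $\mathcal T^{-1}\mathcal L\mathcal T=\begin{bmatrix}0&0\\0&\bar{\mathcal L}\end{bmatrix}$ (for instance, if $\mathcal L$ is diagonalizable over $\mathbb R$, $\bar{\mathcal L}$ may be the diagonal matrix of its remaining eigenvalues). With $m=n-1$ put $$A_{f_2}=\begin{bmatrix}0&I_m\\0&hI_m\end{bmatrix},\quad A_{f_3}=\begin{bmatrix}0&\mu\\-1&-1\end{bmatrix},\quad A_{f_4}=\begin{bmatrix}0&\mu I_m\\-I_m&-I_m\end{bmatrix},\quad A_{g_2}=\begin{bmatrix}I_m&0\\-\gamma\bar{\mathcal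 L}&0\end{bmatrix}.$$ **Theorem.** Let $P_1\in\mathbb R^{2m\times 2m}$, $P_2\in\mathbb R^{2\times2}$, $P_3\in\mathbb R^{2m\times2m}$ be symmetric positive definite, and let $\epsilon,\beta_1,\beta_2>0$ and $\kappa_2$ be real numbers such that $$P_2A_{f_3}+A_{f_3}^\top P_2\prec0,\qquad P_3A_{f_4}+A_{f_4}^\top P_3\prec0,$$ $$P_2A_{f_3}+A_{f_3}^\top P_2\preceq-\beta_1I_2,\qquad P_3A_{f_4}+A_{f_4}^\top P_3\preceq-\beta_2I_{2m},$$ $$A_{g_2}^\top e^{A_{f_2}^\top\nu}P_1e^{A_{f_2}\nu}A_{g_2}-P_1\prec0\qquad\forall\nu\in[T_1,T_2],$$ $$\kappa_2\in\Big(0,\,-\min_{\nu\in[T_1,T_2]}\lambda_{\min}\big(A_{g_2}^\top e^{A_{f_2}^\top\nu}P_1e^{A_{f_2}\nu}A_{g_2}-P_1\big)\Big),$$ $$\Big|\exp\Big(\frac{\bar\kappa_1}{\alpha_2}T_2\Big)\Big(1-\frac{\bar\kappa_2}{\alpha_2}\Big)\Big|<1,$$ where $$\kappa_1=2\max_{\nu\in[0,T_2]}\big|e^{A_{f_2}^\top\nu}P_1e^{A_{f_2}\nu}\big|,\qquad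 \bar\kappa_1=\max\Big\{\frac{\kappa_1}{2\epsilon},\frac{\kappa_1\epsilon}2-\beta_2\Big\},\qquad \bar\kappa_2=\min\{1,\kappa_2\},$$ $$\alpha_2=\max_{\nu\in[0,T_2]}\big\{e^{2h\nu},\ \lambda_{\max}\big(e^{A_{f_2}^\top\nu}P_1e^{A_{f_2}\nu}\big),\ \lambda_{\max}(P_2),\ \lambda_{\max}(P_3)\big\},$$ and $|\cdot|$ of a matrix is the spectral norm. Then $\mathcal A$ is globally exponentially stable for $\mathcal H$: $\mathcal A$ is closed and nonempty, and there are $\kappa,\alpha>0$ such that every maximal solution $\phi$ of $\mathcal H$ is complete (its hybrid time domain is unbounded) and satisfies $$|\phi(t,j)|_{\mathcal A}\le\kappa e^{-\alpha(t+j)}|\phi(0,0)|_{\mathcal A}\qquad\text{for all }(t,j)\in\operatorname{dom}\phi,$$ where $|x|_{\mathcal A}$ is the Euclidean distance from $x$ to $\mathcal A$. -/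

import Mathlib

open Set

noncomputable section

/-! ### Hybrid systems, hybrid time domains, solutions -/

/-- Data `(C, f, D, G)` of a hybrid system: flow set, flow map, jump set, set-valued jump map. -/
structure HybridSystem (E : Type*) where
  /-- flow set -/
  C : Set E
  /-- flow map -/
  f : E → E
  /-- jump set -/
  D : Set E
  /-- jump map -/
  G : E → Set E

/-- Hybrid time domains: nonempty sets of hybrid times `(t, j)` whose truncation at every element
`(T, J)` is `⋃_{j = 0}^{J} [t_j, t_{j+1}] × {j}` with `0 = t_0 ≤ t_1 ≤ ⋯ ≤ t_{J+1}`. -/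
def IsHybridTimeDomain (S : Set (ℝ × ℕ)) : Prop :=
  S.Nonempty ∧ (∀ p ∈ S, 0 ≤ p.1) ∧
    ∀ T J, (T, J) ∈ S → ∃ s : ℕ → ℝ, s 0 = 0 ∧ (∀ j ≤ J, s j ≤ s (j + 1)) ∧
      S ∩ (Icc 0 T ×ˢ Iic J) = ⋃ j ∈ Iic J, Icc (s j) (s (j + 1)) ×ˢ {j}

/-- The slice `I^j = {t | (t, j) ∈ S}`. -/
def slice (S : Set (ℝ × ℕ)) (j : ℕ) : Set ℝ := {t | (t, j) ∈ S}

/-- Hybrid arcs. Only the values of `val` on `dom` matter. -/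
structure HybridArc (E : Type*) [PseudoMetricSpace E] where
  /-- the domain of the arc -/
  dom : Set (ℝ × ℕ)
  /-- the value at the hybrid time `(t, j)` -/
  val : ℝ → ℕ → E
  isHybridTimeDomain : IsHybridTimeDomain dom
  locallyAC : ∀ j a b, a ≤ b → Icc a b ⊆ slice dom j →
    AbsolutelyContinuousOnInterval (fun t => val t j) a b

namespace HybridSystem

variable {E : Type*} [NormedAddCommGroup E] [NormedSpace ℝ E]

/-- Solutions of a hybrid system. -/
structure IsSolution (H : HybridSystem E) (φ : HybridArc E) : Prop where
  init : φ.val 0 0 ∈ closure H.C ∪ H.D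
  flow_mem : ∀ j, ∀ t ∈ interior (slice φ.dom j), φ.val t j ∈ H.C
  flow_deriv : ∀ j, ∀ᵐ t ∂MeasureTheory.volume, t ∈ interior (slice φ.dom j) →
    HasDerivAt (fun s => φ.val s j) (H.f (φ.val t j)) t
  jump : ∀ t j, (t, j) ∈ φ.dom → (t, j + 1) ∈ φ.dom →
    φ.val t j ∈ H.D ∧ φ.val t (j + 1) ∈ H.G (φ.val t j)

/-- A solution is maximal if no solution on a strictly larger domain agrees with it. -/
def IsMaximalSolution (H : HybridSystem E) (φ : HybridArc E) : Prop :=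
  H.IsSolution φ ∧ ¬ ∃ ψ : HybridArc E, H.IsSolution ψ ∧ φ.dom ⊂ ψ.dom ∧
    ∀ t j, (t, j) ∈ φ.dom → ψ.val t j = φ.val t j

end HybridSystem

/-- A hybrid arc is complete if its domain is unbounded. -/
def HybridArc.IsComplete {E : Type*} [PseudoMetricSpace E] (φ : HybridArc E) : Prop :=
  ¬ Bornology.IsBounded φ.dom

/-- Global exponential stability of a (closed, nonempty) set for a hybrid system. -/
def HybridSystem.GloballyExponentiallyStable {E : Type*} [NormedAddCommGroup E] [NormedSpace ℝ E]
    (H : HybridSystem E) (𝒜 : Set E) : Prop :=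
  IsClosed 𝒜 ∧ 𝒜.Nonempty ∧ ∃ κ > 0, ∃ α > 0, ∀ φ : HybridArc E, H.IsMaximalSolution φ →
    φ.IsComplete ∧ ∀ t j, (t, j) ∈ φ.dom →
      Metric.infDist (φ.val t j) 𝒜 ≤
        κ * Real.exp (-α * (t + j)) * Metric.infDist (φ.val 0 0) 𝒜

/-! ### Digraphs -/

/-- There is a directed path between any two nodes. -/
def Digraph.IsStronglyConnected {V : Type*} (𝒢 : Digraph V) : Prop :=
  ∀ i k : V, Relation.ReflTransGen 𝒢.Adj i k

open Classical in
/-- The adjacency matrix: `a_{ik} = 1` if `(i, k)` is an edge, and `0` otherwise. -/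
def Digraph.adjacency {V : Type*} (𝒢 : Digraph V) : Matrix V V ℝ :=
  Matrix.of fun i k => if 𝒢.Adj i k then 1 else 0

/-- The in-degree `∑_k a_{ki}`. -/
def Digraph.inDeg {V : Type*} [Fintype V] (𝒢 : Digraph V) (i : V) : ℝ :=
  ∑ k, 𝒢.adjacency k i

/-- The in-degree Laplacian: `(ℒ e)_i = ∑_{k : (k, i) an edge} (e_i - e_k)`, so `ℒ 1 = 0`. -/
def Digraph.laplacian {V : Type*} [Fintype V] [DecidableEq V] (𝒢 : Digraph V) : Matrix V V ℝ :=
  Matrix.diagonal 𝒢.inDeg - 𝒢.adjacency.transpose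

/-! ### The HyNTP closed loop -/

namespace HyNTP

/-- The state `x = (e, u, η, τ*, â, τ̂, τ)`: six real coordinates for each of the `n` nodes,
and the timer, with the Euclidean norm. -/
abbrev State (n : ℕ) : Type := EuclideanSpace ℝ ((Fin 6 × Fin n) ⊕ Unit)

namespace State

variable {n : ℕ}

/-- The state with the given components. -/
def mk (e u η τs ahat τhat : Fin n → ℝ) (τ : ℝ) : State n :=
  WithLp.toLp 2 (Sum.elim (fun p => (![e, u, η, τs, ahat, τhat] : Fin 6 → Fin n → ℝ) p.1 p.2)
    (fun _ => τ))

/-- clock errors -/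
def e (x : State n) : Fin n → ℝ := fun i => x (Sum.inl (0, i))
/-- control inputs -/
def u (x : State n) : Fin n → ℝ := fun i => x (Sum.inl (1, i))
/-- distributed controller states -/
def η (x : State n) : Fin n → ℝ := fun i => x (Sum.inl (2, i))
/-- internal clocks `τ*` -/
def τs (x : State n) : Fin n → ℝ := fun i => x (Sum.inl (3, i))
/-- clock drift estimates `â` -/
def ahat (x : State n) : Fin n → ℝ := fun i => x (Sum.inl (4, i))
/-- estimates `τ̂` of the internal clocks -/
def τhat (x : State n) : Fin n → ℝ := fun i => x (Sum.inl (5, i))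
/-- the timer -/
def timer (x : State n) : ℝ := x (Sum.inr ())

end State

/-- The state space: internal clocks `τ*` in `[0, ∞)`, timer in `[0, T₂]`. -/
def stateSpace (n : ℕ) (T₂ : ℝ) : Set (State n) :=
  {x | (∀ i, 0 ≤ x.τs i) ∧ x.timer ∈ Icc 0 T₂}

/-- The closed-loop hybrid system. `a` are the clock drifts, `σ` the prescribed clock rate. -/
def closedLoop {n : ℕ} (𝒢 : Digraph (Fin n)) (a : Fin n → ℝ) (σ T₁ T₂ μ h γ : ℝ) :
    HybridSystem (State n) where
  C := stateSpace n T₂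
  f x := State.mk
    (fun i => a i + x.u i - σ)
    (fun i => h * x.η i - μ * (x.τhat i - x.τs i))
    (fun i => h * x.η i)
    a
    (fun i => -μ * (x.τhat i - x.τs i))
    (fun i => x.ahat i - (x.τhat i - x.τs i))
    (-1)
  D := {x ∈ stateSpace n T₂ | x.timer = 0}
  G x := {y | ∃ ν ∈ Icc T₁ T₂, y = State.mk
    x.e
    (fun i => -γ * 𝒢.laplacian.mulVec x.e i - x.ahat i + σ)
    (fun i => -γ * 𝒢.laplacian.mulVec x.e i)
    x.τs x.ahat x.τhat ν}

/-- The synchronization set. -/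
def syncSet {n : ℕ} (a : Fin n → ℝ) (σ T₂ : ℝ) : Set (State n) :=
  {x ∈ stateSpace n T₂ | ∀ i k, x.e i = x.e k ∧ x.η i = 0 ∧ x.ahat i = a i ∧
    x.τhat i = x.τs i ∧ x.u i = x.η i - x.ahat i + σ}

/-! ### The matrices and constants of the design conditions (`n = m + 1` nodes) -/

/-- `L = diag(0, Lbar)` in the coordinates given by a nonsingular matrix `T` whose first column
is `1/√n` times the vector of ones. -/
structure IsBlockForm {m : ℕ} (L : Matrix (Fin (m + 1)) (Fin (m + 1)) ℝ)
    (T : Matrix (Fin (m + 1)) (Fin (m + 1)) ℝ) (Lbar : Matrix (Fin m) (Fin m) ℝ) : Prop where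
  nonsingular : IsUnit T.det
  first_col : ∀ i, T i 0 = 1 / Real.sqrt ((m + 1 : ℕ) : ℝ)
  conj_eq : T⁻¹ * L * T = Matrix.of (Matrix.vecCons 0 fun i => Matrix.vecCons 0 (Lbar i))

/-- `A_{f₂} = [0, I; 0, h I]`. -/
def Af2 (m : ℕ) (h : ℝ) : Matrix (Fin m ⊕ Fin m) (Fin m ⊕ Fin m) ℝ :=
  Matrix.fromBlocks 0 1 0 (h • 1)

/-- `A_{f₃} = [0, μ; -1, -1]`. -/
def Af3 (μ : ℝ) : Matrix (Fin 2) (Fin 2) ℝ := !![0, μ; -1, -1]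

/-- `A_{f₄} = [0, μ I; -I, -I]`. -/
def Af4 (m : ℕ) (μ : ℝ) : Matrix (Fin m ⊕ Fin m) (Fin m ⊕ Fin m) ℝ :=
  Matrix.fromBlocks 0 (μ • 1) (-1) (-1)

/-- `A_{g₂} = [I, 0; -γ Lbar, 0]`. -/
def Ag2 {m : ℕ} (γ : ℝ) (Lbar : Matrix (Fin m) (Fin m) ℝ) :
    Matrix (Fin m ⊕ Fin m) (Fin m ⊕ Fin m) ℝ :=
  Matrix.fromBlocks 1 0 (-γ • Lbar) 0

section Eigenvalues

variable {ι : Type*} [Fintype ι] [DecidableEq ι]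

/-- Largest eigenvalue of a symmetric matrix. -/
def lamMax (M : Matrix ι ι ℝ) : ℝ := sSup (spectrum ℝ M)

/-- Smallest eigenvalue of a symmetric matrix. -/
def lamMin (M : Matrix ι ι ℝ) : ℝ := sInf (spectrum ℝ M)

/-- The matrix norm `|M| = max {√|λ| : λ an eigenvalue of Mᵀ M}`. -/
def matNorm (M : Matrix ι ι ℝ) : ℝ :=
  sSup ((fun l : ℝ => Real.sqrt |l|) '' spectrum ℝ (M.transpose * M))

end Eigenvalues

variable {m : ℕ}

/-- `exp(A_{f₂}ᵀ ν) P₁ exp(A_{f₂} ν)`. -/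
def flowP (h : ℝ) (P₁ : Matrix (Fin m ⊕ Fin m) (Fin m ⊕ Fin m) ℝ) (ν : ℝ) :
    Matrix (Fin m ⊕ Fin m) (Fin m ⊕ Fin m) ℝ :=
  NormedSpace.exp (ν • (Af2 m h).transpose) * P₁ * NormedSpace.exp (ν • Af2 m h)

/-- `A_{g₂}ᵀ exp(A_{f₂}ᵀ ν) P₁ exp(A_{f₂} ν) A_{g₂} - P₁`. -/
def jumpQ (h γ : ℝ) (Lbar : Matrix (Fin m) (Fin m) ℝ)
    (P₁ : Matrix (Fin m ⊕ Fin m) (Fin m ⊕ Fin m) ℝ) (ν : ℝ) :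
    Matrix (Fin m ⊕ Fin m) (Fin m ⊕ Fin m) ℝ :=
  (Ag2 γ Lbar).transpose * flowP h P₁ ν * Ag2 γ Lbar - P₁

/-- `κ₁ = 2 max_{ν ∈ [0, T₂]} |exp(A_{f₂}ᵀ ν) P₁ exp(A_{f₂} ν)|`. -/
def kappa1 (h T₂ : ℝ) (P₁ : Matrix (Fin m ⊕ Fin m) (Fin m ⊕ Fin m) ℝ) : ℝ :=
  2 * sSup ((fun ν => matNorm (flowP h P₁ ν)) '' Icc 0 T₂)

/-- `κ̄₁ = max {κ₁ / (2 ε), κ₁ ε / 2 - β₂}`. -/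
def kappaBar1 (h T₂ ε β₂ : ℝ) (P₁ : Matrix (Fin m ⊕ Fin m) (Fin m ⊕ Fin m) ℝ) : ℝ :=
  max (kappa1 h T₂ P₁ / (2 * ε)) (kappa1 h T₂ P₁ * ε / 2 - β₂)

/-- The upper end of the admissible interval for `κ₂`:
`- min_{ν ∈ [T₁, T₂]} λ_min (A_{g₂}ᵀ exp(A_{f₂}ᵀ ν) P₁ exp(A_{f₂} ν) A_{g₂} - P₁)`. -/
def kappa2Bound (h γ T₁ T₂ : ℝ) (Lbar : Matrix (Fin m) (Fin m) ℝ)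
    (P₁ : Matrix (Fin m ⊕ Fin m) (Fin m ⊕ Fin m) ℝ) : ℝ :=
  -sInf ((fun ν => lamMin (jumpQ h γ Lbar P₁ ν)) '' Icc T₁ T₂)

/-- `α₂ = max_{ν ∈ [0, T₂]} {exp(2 h ν), λ_max(exp(A_{f₂}ᵀ ν) P₁ exp(A_{f₂} ν)),
λ_max(P₂), λ_max(P₃)}`. -/
def alpha2 (h T₂ : ℝ) (P₁ : Matrix (Fin m ⊕ Fin m) (Fin m ⊕ Fin m) ℝ)
    (P₂ : Matrix (Fin 2) (Fin 2) ℝ) (P₃ : Matrix (Fin m ⊕ Fin m) (Fin m ⊕ Fin m) ℝ) : ℝ :=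
  sSup ((fun ν => max (max (Real.exp (2 * h * ν)) (lamMax (flowP h P₁ ν)))
    (max (lamMax P₂) (lamMax P₃))) '' Icc 0 T₂)

end HyNTP

end

/-!
In the error coordinates the closed loop is a cascade of linear hybrid systems.

* The estimation errors `a - â` and `τ̂ - τ*` of each node form an autonomous planar system with
  matrix `A_{f₃}` that the jumps do not touch. The Lyapunov inequality for `P₂` makes them decay
  exponentially in ordinary time (`HyNTP.exists_estimation_decay`).
* The deviation of `u` from `η - â + σ` is driven by `τ̂ - τ*` only, and every jump resets it to zero.
* Let `R` consist of the lower rows of `T⁻¹`. Since `R` kills the consensus direction and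
  `R ℒ = Lbar R`, the pair `(R e, R η)` flows with `A_{f₂}`, up to a perturbation by the errors
  above, and jumps with `A_{g₂}`. The jump condition says that `exp (ν A_{f₂}) A_{g₂}` decreases the
  norm of `P₁` for each `ν ∈ [T₁, T₂]`; by compactness it does so by a uniform factor
  (`HyNTP.exists_contraction_of_jumpQ`).

Hence the norm of `P₁` of `(R e, R η)`, plus a large multiple of the norm of `P₂` of the estimation
errors, contracts by a fixed factor from the state before a jump to the state before the next one
(`HyNTP.exists_lyapunov`). In between, the error grows at most by a constant factor
(`HyNTP.exists_errSize_flow_le`), and at most time `T₂` passes, so the decay is exponential in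
`t + j` (`HyNTP.exists_exponential_decay`). On the state space the error is comparable to the
distance to the synchronization set: if `R e = 0` then `e` is a consensus vector
(`HyNTP.exists_infDist_le_errSize`, `HyNTP.exists_errSize_le_infDist`).

To use this for solutions in the sense of absolutely continuous arcs, one shows that an arc
satisfying an autonomous Lipschitz equation almost everywhere is a classical solution
(`AbsolutelyContinuousOnInterval.eqOn_of_ae_hasDerivAt`). A maximal solution with bounded domain
could be extended, by the flow until the timer expires or else by a jump
(`HyNTP.isComplete_of_isMaximalSolution`).
-/

noncomputable section

/-! ### Hybrid time domains and their extensions -/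

/-- A pointwise form of the definition of hybrid time domains, in which the last switching time of
the truncation at `(T, J)` is identified as `T`. -/
theorem isHybridTimeDomain_iff {S : Set (ℝ × ℕ)} :
    IsHybridTimeDomain S ↔ S.Nonempty ∧ (∀ p ∈ S, 0 ≤ p.1) ∧
      ∀ T J, (T, J) ∈ S → ∃ s : ℕ → ℝ, s 0 = 0 ∧ s (J + 1) = T ∧ (∀ j ≤ J, s j ≤ s (j + 1)) ∧
        ∀ j ≤ J, ∀ t, ((t, j) ∈ S ∧ t ≤ T) ↔ t ∈ Icc (s j) (s (j + 1)) := by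
  unfold IsHybridTimeDomain
  refine and_congr_right fun _ => and_congr_right fun hpos => forall₂_congr fun T J =>
    forall_congr' fun hTJ => exists_congr fun s => and_congr_right fun _ => ?_
  have key : (S ∩ (Icc 0 T ×ˢ Iic J) = ⋃ j ∈ Iic J, Icc (s j) (s (j + 1)) ×ˢ {j}) ↔
      ∀ j ≤ J, ∀ t, ((t, j) ∈ S ∧ t ≤ T) ↔ t ∈ Icc (s j) (s (j + 1)) := by
    rw [Set.ext_iff]
    simp only [Prod.forall, mem_inter_iff, mem_prod, mem_Iic, mem_Icc, mem_iUnion,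
      mem_singleton_iff, exists_prop]
    constructor
    · intro H j hj t
      have := H t j
      constructor
      · rintro ⟨h1, h2⟩
        obtain ⟨i, _, hi, rfl⟩ := this.1 ⟨h1, ⟨hpos _ h1, h2⟩, hj⟩
        exact hi
      · intro h
        obtain ⟨h1, ⟨_, h2⟩, _⟩ := this.2 ⟨j, hj, h, rfl⟩
        exact ⟨h1, h2⟩
    · intro H t j
      constructor
      · rintro ⟨h1, ⟨_, h2⟩, hj⟩
        exact ⟨j, hj, (H j hj t).1 ⟨h1, h2⟩, rfl⟩
      · rintro ⟨i, hi, h, rfl⟩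
        obtain ⟨h1, h2⟩ := (H j hi t).2 h
        exact ⟨h1, ⟨hpos _ h1, h2⟩, hi⟩
  rw [key]
  constructor
  · rintro ⟨h1, h2⟩
    refine ⟨le_antisymm ?_ ?_, h1, h2⟩
    · exact ((h2 J le_rfl _).2 ⟨h1 J le_rfl, le_rfl⟩).2
    · exact ((h2 J le_rfl T).1 ⟨hTJ, le_rfl⟩).2
  · rintro ⟨_, h1, h2⟩
    exact ⟨h1, h2⟩

namespace IsHybridTimeDomain

variable {S : Set (ℝ × ℕ)}

theorem zero_mem (hS : IsHybridTimeDomain S) : ((0 : ℝ), 0) ∈ S := by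
  obtain ⟨⟨⟨T, J⟩, hTJ⟩, _, h⟩ := isHybridTimeDomain_iff.1 hS
  obtain ⟨s, h0, _, hle, hs⟩ := h T J hTJ
  have := (hs 0 (Nat.zero_le _) 0).2 (by
    rw [← h0]; exact ⟨le_rfl, hle 0 (Nat.zero_le _)⟩)
  exact this.1

theorem Icc_subset_slice (hS : IsHybridTimeDomain S) {t t' : ℝ} {j : ℕ} (h : (t, j) ∈ S)
    (h' : (t', j) ∈ S) : Icc t t' ⊆ slice S j := by
  intro r hr
  obtain ⟨_, _, H⟩ := isHybridTimeDomain_iff.1 hS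
  obtain ⟨s, _, hT, _, hs⟩ := H t' j h'
  refine ((hs j le_rfl r).2 ⟨?_, ?_⟩).1
  · exact ((hs j le_rfl t).1 ⟨h, hr.1.trans hr.2⟩).1.trans hr.1
  · rw [hT]; exact hr.2

/-- Every nonempty slice has a least element. -/
theorem exists_start (hS : IsHybridTimeDomain S) {t : ℝ} {j : ℕ} (h : (t, j) ∈ S) :
    ∃ t₀ ≤ t, (t₀, j) ∈ S ∧ ∀ r, (r, j) ∈ S → t₀ ≤ r := by
  obtain ⟨_, _, H⟩ := isHybridTimeDomain_iff.1 hS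
  obtain ⟨s, _, hT, hle, hs⟩ := H t j h
  have hst : s j ≤ t := hT ▸ hle j le_rfl
  refine ⟨s j, hst, ((hs j le_rfl _).2 ⟨le_rfl, hle j le_rfl⟩).1, fun r hr => ?_⟩
  rcases le_total r t with hrt | hrt
  · exact ((hs j le_rfl r).1 ⟨hr, hrt⟩).1
  · exact hst.trans hrt

/-- If no later slice is occupied and all earlier slices end before `t₀`, then the slice starting
at `t₀` may be prolonged. -/
theorem union_Icc (hS : IsHybridTimeDomain S) {t₀ t₁ : ℝ} {J : ℕ}
    (h0 : (t₀, J) ∈ S) (hmin : ∀ r, (r, J) ∈ S → t₀ ≤ r) (htop : ∀ p ∈ S, p.2 ≤ J)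
    (hprev : ∀ p ∈ S, p.2 < J → p.1 ≤ t₀) :
    IsHybridTimeDomain (S ∪ Icc t₀ t₁ ×ˢ {J}) := by
  obtain ⟨hne, hpos, H⟩ := isHybridTimeDomain_iff.1 hS
  refine isHybridTimeDomain_iff.2 ⟨hne.mono subset_union_left, ?_, ?_⟩
  · rintro ⟨t, j⟩ (h | h)
    · exact hpos _ h
    · exact (hpos _ h0).trans h.1.1
  · intro T' J' hmem
    by_cases hold : (T', J') ∈ S
    · obtain ⟨s, hs0, hsT, hle, hs⟩ := H T' J' hold
      refine ⟨s, hs0, hsT, hle, fun j hj t => ?_⟩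
      rw [← hs j hj t]
      refine and_congr_left fun htT => ⟨?_, fun h => Or.inl h⟩
      rintro (h | ⟨ht, hjJ⟩)
      · exact h
      · obtain rfl : j = J := hjJ
        obtain rfl : J' = j := le_antisymm (htop _ hold) hj
        exact hS.Icc_subset_slice h0 hold ⟨ht.1, htT⟩
    · obtain ⟨hT', hJ'⟩ : T' ∈ Icc t₀ t₁ ∧ J' = J := hmem.resolve_left hold
      subst hJ'
      obtain ⟨s, hs0, hsT, hle, hs⟩ := H t₀ J' h0
      have hsJ : s J' = t₀ := le_antisymm (hsT ▸ hle J' le_rfl)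
        (hmin _ ((hs J' le_rfl _).2 ⟨le_rfl, hle J' le_rfl⟩).1)
      refine ⟨Function.update s (J' + 1) T', by simpa using hs0, by simp, fun j hj => ?_,
        fun j hj t => ?_⟩
      · rw [Function.update_of_ne (by omega)]
        rcases hj.lt_or_eq with hj' | rfl
        · rw [Function.update_of_ne (by omega)]; exact hle j hj
        · simpa [hsJ] using hT'.1
      · rw [Function.update_of_ne (by omega : j ≠ J' + 1)]
        rcases hj.lt_or_eq with hj' | rfl
        · rw [Function.update_of_ne (by omega), ← hs j hj t]
          constructor
          · rintro ⟨h | h, _⟩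
            · exact ⟨h, hprev _ h hj'⟩
            · exact absurd h.2 hj'.ne
          · rintro ⟨h, ht⟩
            exact ⟨Or.inl h, ht.trans hT'.1⟩
        · rw [hsJ, Function.update_self]
          constructor
          · rintro ⟨h | h, ht⟩
            · exact ⟨hmin _ h, ht⟩
            · exact ⟨h.1.1, ht⟩
          · rintro ⟨h1, h2⟩
            exact ⟨Or.inr ⟨⟨h1, h2.trans hT'.2⟩, rfl⟩, h2⟩

/-- If no later slice is occupied, a jump may be added at any time of the last slice. -/
theorem insert_jump (hS : IsHybridTimeDomain S) {T : ℝ} {J : ℕ} (hT : (T, J) ∈ S)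
    (htop : ∀ p ∈ S, p.2 ≤ J) : IsHybridTimeDomain (insert (T, J + 1) S) := by
  obtain ⟨hne, hpos, H⟩ := isHybridTimeDomain_iff.1 hS
  refine isHybridTimeDomain_iff.2 ⟨hne.mono (subset_insert _ _), ?_, ?_⟩
  · rintro p (rfl | h)
    · exact hpos (T, J) hT
    · exact hpos _ h
  · rintro T' J' (hnew | hold)
    · obtain ⟨rfl, rfl⟩ := Prod.mk.inj hnew
      obtain ⟨s, hs0, hsT, hle, hs⟩ := H T' J hT
      refine ⟨Function.update s (J + 1 + 1) T', by simpa using hs0, by simp, fun j hj => ?_,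
        fun j hj t => ?_⟩
      · rw [Function.update_of_ne (by omega)]
        rcases hj.lt_or_eq with hj' | rfl
        · rw [Function.update_of_ne (by omega)]; exact hle j (by omega)
        · simp [hsT]
      · rw [Function.update_of_ne (by omega : j ≠ J + 1 + 1)]
        rcases hj.lt_or_eq with hj' | rfl
        · rw [Function.update_of_ne (by omega), ← hs j (by omega) t]
          refine and_congr_left fun _ => ⟨?_, fun h => Or.inr h⟩
          rintro (h | h)
          · have := (Prod.mk.inj h).2; omega
          · exact h
        · rw [hsT, Function.update_self]
          constructor
          · rintro ⟨h | h, _⟩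
            · obtain rfl := (Prod.mk.inj h).1
              exact ⟨le_rfl, le_rfl⟩
            · have := htop _ h
              simp at this
          · rintro ⟨h1, h2⟩
            obtain rfl := le_antisymm h1 h2
            exact ⟨Or.inl rfl, le_rfl⟩
    · obtain ⟨s, hs0, hsT, hle, hs⟩ := H T' J' hold
      refine ⟨s, hs0, hsT, hle, fun j hj t => ?_⟩
      rw [← hs j hj t]
      refine and_congr_left fun _ => ⟨?_, fun h => Or.inr h⟩
      rintro (h | h)
      · have h1 := (Prod.mk.inj h).2
        have h2 := htop _ hold
        simp only at h2
        omega
      · exact h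

end IsHybridTimeDomain

/-! ### Affine differential equations -/

section ODE

variable {E : Type*} [NormedAddCommGroup E] [NormedSpace ℝ E] [CompleteSpace E]

/-- An absolutely continuous curve that satisfies an autonomous Lipschitz equation almost
everywhere coincides with the classical solution from the same initial point. -/
theorem AbsolutelyContinuousOnInterval.eqOn_of_ae_hasDerivAt {v : E → E} {K : NNReal}
    (hv : LipschitzWith K v) {x c : ℝ → E} {a b : ℝ} (hab : a ≤ b)
    (hx : AbsolutelyContinuousOnInterval x a b)
    (hx' : ∀ᵐ t, t ∈ Ioo a b → HasDerivAt x (v (x t)) t)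
    (hc : ∀ t, HasDerivAt c (v (c t)) t) (h0 : x a = c a) : EqOn x c (Icc a b) := by
  -- The integral curve `y` of `v ∘ x` is continuously differentiable and agrees with `x`, so `x`
  -- is a classical solution.
  have hxc : ContinuousOn x (Icc a b) := by simpa [uIcc_of_le hab] using hx.continuousOn
  set w : ℝ → E := IccExtend hab ((Icc a b).domRestrict x) with hw
  have hwc : Continuous w := continuous_IccExtend_iff.2 (continuousOn_iff_continuous_domRestrict.1 hxc)
  have hwx : ∀ t ∈ Icc a b, w t = x t := fun t ht => by
    rw [hw, IccExtend_of_mem _ _ ht]; rfl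
  have hvw : Continuous fun t => v (w t) := hv.continuous.comp hwc
  set y : ℝ → E := fun t => x a + ∫ r in a..t, v (w r) with hy
  have hyd : ∀ t, HasDerivAt y (v (w t)) t := fun t =>
    (intervalIntegral.integral_hasDerivAt_right (hvw.intervalIntegrable _ _)
      (hvw.stronglyMeasurableAtFilter _ _) hvw.continuousAt).const_add _
  have hyC : ContDiff ℝ 1 y := by
    rw [contDiff_one_iff_deriv]
    refine ⟨fun t => (hyd t).differentiableAt, ?_⟩
    rwa [show deriv y = fun t => v (w t) from funext fun t => (hyd t).deriv]
  obtain ⟨C, hC⟩ := (hx.sub hyC.contDiffOn.absolutelyContinuousOnInterval).const_of_ae_hasDerivAt_zero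
    (by
      have hne : ∀ r : ℝ, ∀ᵐ t : ℝ, t ≠ r := fun r => by
        simp [MeasureTheory.ae_iff, MeasureTheory.measure_singleton]
      filter_upwards [hx', hne a, hne b] with t ht hta htb htm
      rw [uIcc_of_le hab] at htm
      have h1 := ht ⟨lt_of_le_of_ne htm.1 (Ne.symm hta), lt_of_le_of_ne htm.2 htb⟩
      have h2 := hyd t
      rw [hwx t htm] at h2
      simpa using h1.sub h2)
  rw [uIcc_of_le hab] at hC
  have hya : y a = x a := by simp [hy]
  have hC0 : C = 0 := by rw [← hC a ⟨le_rfl, hab⟩]; simp [hya]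
  have hxy : EqOn x y (Icc a b) := fun t ht => by
    have := hC t ht
    rw [hC0] at this
    exact sub_eq_zero.1 this
  refine hxy.trans (ODE_solution_unique (v := fun _ => v) (fun _ => hv)
    hyC.continuous.continuousOn (fun t ht => ?_)
    (fun t _ => (hc t).continuousAt.continuousWithinAt)
    (fun t _ => (hc t).hasDerivWithinAt) (by rw [hya, h0]))
  have := (hyd t).hasDerivWithinAt (s := Ici t)
  rwa [hwx t (Ico_subset_Icc_self ht), hxy (Ico_subset_Icc_self ht)] at this

/-- Global solvability of an affine equation, from the exponential of the linear map
`(x, r) ↦ (F x + r • w, 0)` on `E × ℝ`. -/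
theorem exists_hasDerivAt_affine (F : E →L[ℝ] E) (w x₀ : E) :
    ∃ c : ℝ → E, c 0 = x₀ ∧ ∀ t, HasDerivAt c (F (c t) + w) t := by
  let F' : E × ℝ →L[ℝ] E × ℝ :=
    (F.comp (ContinuousLinearMap.fst ℝ E ℝ) +
      (ContinuousLinearMap.snd ℝ E ℝ).smulRight w).prod 0
  let p : ℝ → E × ℝ := fun t => NormedSpace.exp (t • F') (x₀, 1)
  have hp : ∀ t, HasDerivAt p (F' (p t)) t := fun t =>
    (hasDerivAt_exp_smul_const' F' t).clm_apply (hasDerivAt_const t (x₀, (1 : ℝ))) |>.congr_deriv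
      (by simp [p])
  have hp0 : p 0 = (x₀, 1) := by simp [p]
  have h2 : ∀ t, (p t).2 = 1 := fun t => by
    have hd : ∀ r, HasDerivAt (fun r => (p r).2) 0 r := fun r => (hp r).snd
    have := is_const_of_deriv_eq_zero (fun r => (hd r).differentiableAt)
      (fun r => (hd r).deriv) t 0
    simpa [hp0] using this
  refine ⟨fun t => (p t).1, by simp [hp0], fun t => ?_⟩
  have h1 : HasDerivAt (fun t => (p t).1) (F' (p t)).1 t := (hp t).fst
  simpa [F', h2 t] using h1

end ODE

/-! ### Quadratic norms and uniform contraction -/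

section Matrices

open Matrix

/-- The norm `y ↦ √(yᵀ P y)` of a positive definite matrix, with its equivalence to the sup norm. -/
theorem Matrix.PosDef.exists_seminorm {ι : Type*} [Fintype ι] [DecidableEq ι] {P : Matrix ι ι ℝ}
    (hP : P.PosDef) : ∃ N : Seminorm ℝ (ι → ℝ), (∀ y, N y ^ 2 = y ⬝ᵥ (P *ᵥ y)) ∧
      ∃ C > 0, (∀ y, N y ≤ C * ‖y‖) ∧ ∀ y, ‖y‖ ≤ C * N y := by
  open scoped MatrixOrder in
  obtain ⟨B, hB⟩ := CStarAlgebra.nonneg_iff_eq_star_mul_self.mp hP.posSemidef.nonneg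
  let f : (ι → ℝ) →ₗ[ℝ] EuclideanSpace ℝ ι :=
    (WithLp.linearEquiv 2 ℝ (ι → ℝ)).symm.toLinearMap ∘ₗ B.mulVecLin
  have hf : ∀ y, ‖f y‖ ^ 2 = y ⬝ᵥ (P *ᵥ y) := fun y => by
    rw [EuclideanSpace.norm_sq_eq, hB, ← mulVec_mulVec, dotProduct_mulVec, star_eq_conjTranspose,
      conjTranspose_eq_transpose_of_trivial, vecMul_transpose]
    simp [f, dotProduct, sq]
  have hker : LinearMap.ker f = ⊥ := by
    rw [LinearMap.ker_eq_bot']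
    intro y hy
    by_contra hne
    have := hP.dotProduct_mulVec_pos hne
    rw [star_trivial, ← hf y, hy] at this
    simp at this
  obtain ⟨K, -, hK⟩ := f.exists_antilipschitzWith hker
  let g := f.toContinuousLinearMap
  refine ⟨(normSeminorm ℝ _).comp f, hf, max (K : ℝ) (‖g‖ + 1), by positivity, fun y => ?_,
    fun y => ?_⟩
  · refine (g.le_opNorm y).trans (mul_le_mul_of_nonneg_right ?_ (norm_nonneg _))
    exact le_trans (by linarith) (le_max_right _ _)
  · have := hK.le_mul_dist y 0
    simp only [dist_zero_right, map_zero] at this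
    exact this.trans (mul_le_mul_of_nonneg_right (le_max_left _ _) (norm_nonneg _))

/-- A linear map between finite-dimensional function spaces is bounded for the sup norm. -/
theorem Matrix.exists_norm_mulVec_le {ι κ : Type*} [Fintype ι] [Fintype κ] (M : Matrix ι κ ℝ) :
    ∃ C > 0, ∀ v, ‖M *ᵥ v‖ ≤ C * ‖v‖ := by
  let g := M.mulVecLin.toContinuousLinearMap
  refine ⟨‖g‖ + 1, by positivity, fun v => (g.le_opNorm v).trans ?_⟩
  gcongr
  linarith

/-- A continuous family of linear maps, indexed by a compact set, each of which strictly decreases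
a norm `N`, is uniformly contracting for `N`. -/
theorem Seminorm.exists_uniform_contraction {X Y : Type*} [TopologicalSpace X]
    [NormedAddCommGroup Y] [NormedSpace ℝ Y] [FiniteDimensional ℝ Y] (N : Seminorm ℝ Y)
    (hN : Continuous N) {s : Set X} (hs : IsCompact s) (Φ : X → Y →ₗ[ℝ] Y)
    (hΦ : Continuous fun p : X × Y => Φ p.1 p.2)
    (hlt : ∀ ν ∈ s, ∀ y, y ≠ 0 → N (Φ ν y) < N y) :
    ∃ ρ, 0 ≤ ρ ∧ ρ < 1 ∧ ∀ ν ∈ s, ∀ y, N (Φ ν y) ≤ ρ * N y := by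
  have hpos : ∀ ν ∈ s, ∀ y, y ≠ 0 → 0 < N y := fun ν hν y hy =>
    (apply_nonneg N _).trans_lt (hlt ν hν y hy)
  have hK : IsCompact (s ×ˢ Metric.sphere (0 : Y) 1) := hs.prod (isCompact_sphere _ _)
  have hne : ∀ p ∈ s ×ˢ Metric.sphere (0 : Y) 1, p.2 ≠ 0 := fun p hp =>
    ne_zero_of_mem_unit_sphere ⟨p.2, hp.2⟩
  have hcont : ContinuousOn (fun p : X × Y => N (Φ p.1 p.2) / N p.2)
      (s ×ˢ Metric.sphere (0 : Y) 1) :=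
    (hN.comp hΦ).continuousOn.div (hN.comp continuous_snd).continuousOn
      fun p hp => (hpos p.1 hp.1 p.2 (hne p hp)).ne'
  obtain ⟨ρ, hρ0, hρ1, hρ⟩ : ∃ ρ : ℝ, 0 ≤ ρ ∧ ρ < 1 ∧
      ∀ p ∈ s ×ˢ Metric.sphere (0 : Y) 1, N (Φ p.1 p.2) / N p.2 ≤ ρ := by
    rcases (s ×ˢ Metric.sphere (0 : Y) 1).eq_empty_or_nonempty with h | h
    · exact ⟨0, le_rfl, one_pos, by simp [h]⟩
    · obtain ⟨q, hq, hmax⟩ := hK.exists_isMaxOn h hcont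
      refine ⟨_, by positivity, ?_, hmax⟩
      rw [div_lt_one (hpos q.1 hq.1 q.2 (hne q hq))]
      exact hlt q.1 hq.1 q.2 (hne q hq)
  refine ⟨ρ, hρ0, hρ1, fun ν hν y => ?_⟩
  rcases eq_or_ne y 0 with rfl | hy
  · simp
  have hy' : ‖y‖ ≠ 0 := norm_ne_zero_iff.2 hy
  have hmem : ‖y‖⁻¹ • y ∈ Metric.sphere (0 : Y) 1 := by
    simp [norm_smul, hy']
  have := hρ (ν, ‖y‖⁻¹ • y) ⟨hν, hmem⟩
  simp only [map_smul, map_smul_eq_mul] at this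
  rwa [mul_div_mul_left _ _ (by simpa using hy'), div_le_iff₀ (hpos ν hν y hy)] at this

end Matrices

/-! ### The exponential of the flow matrix -/

/-- `∫₀ᵗ e^{hs} ds`, the integral of the impulse response of `η' = h η`. -/
def expInt (h t : ℝ) : ℝ := ∫ s in (0 : ℝ)..t, Real.exp (h * s)

theorem expInt_zero (h : ℝ) : expInt h 0 = 0 := by simp [expInt]

theorem hasDerivAt_expInt (h t : ℝ) : HasDerivAt (expInt h) (Real.exp (h * t)) t := by
  have hc : Continuous fun s => Real.exp (h * s) := by fun_prop
  exact intervalIntegral.integral_hasDerivAt_right (hc.intervalIntegrable _ _)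
    (hc.stronglyMeasurableAtFilter _ _) hc.continuousAt

theorem continuous_expInt (h : ℝ) : Continuous (expInt h) :=
  continuous_iff_continuousAt.2 fun t => (hasDerivAt_expInt h t).continuousAt

theorem mul_expInt (h t : ℝ) : h * expInt h t = Real.exp (h * t) - 1 := by
  have hd : ∀ r, HasDerivAt (fun r => h * expInt h r - Real.exp (h * r)) 0 r := fun r => by
    have h1 := ((hasDerivAt_expInt h r).const_mul h).sub
      (((hasDerivAt_id r).const_mul h).exp)
    refine h1.congr_deriv ?_
    simp
    ring
  have := is_const_of_deriv_eq_zero (fun r => (hd r).differentiableAt) (fun r => (hd r).deriv) t 0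
  simp only [expInt_zero, mul_zero, Real.exp_zero] at this
  linarith

/-- The exponential of an element with `A² = h A`. -/
theorem NormedSpace.exp_smul_of_mul_self {𝔸 : Type*} [NormedRing 𝔸] [NormedAlgebra ℝ 𝔸]
    [CompleteSpace 𝔸] {A : 𝔸} {h : ℝ} (hA : A * A = h • A) (t : ℝ) :
    NormedSpace.exp (t • A) = 1 + expInt h t • A := by
  -- `exp (-tA) (1 + expInt h t • A)` has derivative zero.
  have hd : ∀ r : ℝ, HasDerivAt
      (fun r : ℝ => NormedSpace.exp (r • -A) * (1 + expInt h r • A)) 0 r := fun r => by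
    refine ((hasDerivAt_exp_smul_const (-A) r).mul
      (((hasDerivAt_expInt h r).smul_const A).const_add 1)).congr_deriv ?_
    rw [mul_assoc, ← mul_add]
    convert mul_zero _
    rw [mul_add, mul_one, mul_smul_comm, neg_mul, hA, smul_neg, smul_smul, mul_comm (expInt h r),
      mul_expInt, sub_smul, one_smul]
    abel
  have := is_const_of_deriv_eq_zero (fun r => (hd r).differentiableAt) (fun r => (hd r).deriv) t 0
  simp only [zero_smul, NormedSpace.exp_zero, expInt_zero, add_zero, mul_one] at this
  have hinv : NormedSpace.exp (t • A) * NormedSpace.exp (t • -A) = 1 := by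
    let : NormedAlgebra ℚ 𝔸 := NormedAlgebra.restrictScalars ℚ ℝ 𝔸
    rw [← NormedSpace.exp_add_of_commute (((Commute.refl A).neg_right.smul_left t).smul_right t)]
    simp
  calc NormedSpace.exp (t • A)
      = NormedSpace.exp (t • A) * (NormedSpace.exp (t • -A) * (1 + expInt h t • A)) := by
        rw [this, mul_one]
    _ = 1 + expInt h t • A := by rw [← mul_assoc, hinv, one_mul]

namespace HyNTP

open Matrix

theorem exp_smul_Af2 (m : ℕ) (h t : ℝ) :
    NormedSpace.exp (t • Af2 m h) = 1 + expInt h t • Af2 m h := by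
  let : NormedRing (Matrix (Fin m ⊕ Fin m) (Fin m ⊕ Fin m) ℝ) := Matrix.linftyOpNormedRing
  let : NormedAlgebra ℝ (Matrix (Fin m ⊕ Fin m) (Fin m ⊕ Fin m) ℝ) :=
    Matrix.linftyOpNormedAlgebra
  refine NormedSpace.exp_smul_of_mul_self ?_ t
  simp [Af2, fromBlocks_multiply, fromBlocks_smul, smul_smul]

theorem one_add_smul_Af2_mulVec {m : ℕ} (h r : ℝ) (z w : Fin m → ℝ) :
    (1 + r • Af2 m h) *ᵥ Sum.elim z w = Sum.elim (z + r • w) (w + (r * h) • w) := by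
  rw [add_mulVec, one_mulVec, smul_mulVec, Af2, fromBlocks_mulVec]
  ext (i | i) <;> simp [smul_mulVec, mul_assoc]

theorem Ag2_mulVec {m : ℕ} (γ : ℝ) (Lbar : Matrix (Fin m) (Fin m) ℝ) (z w : Fin m → ℝ) :
    Ag2 γ Lbar *ᵥ Sum.elim z w = Sum.elim z (-γ • (Lbar *ᵥ z)) := by
  rw [Ag2, fromBlocks_mulVec]
  ext (i | i) <;> simp [neg_mulVec, smul_mulVec]

/-- The jump condition says that `exp (ν A_{f₂}) A_{g₂}` decreases the norm of `P₁`. -/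
theorem exists_contraction_of_jumpQ {m : ℕ} {h γ T₁ T₂ : ℝ} {Lbar : Matrix (Fin m) (Fin m) ℝ}
    {P₁ : Matrix (Fin m ⊕ Fin m) (Fin m ⊕ Fin m) ℝ}
    (hJump : ∀ ν ∈ Icc T₁ T₂, (-(jumpQ h γ Lbar P₁ ν)).PosDef)
    {N : Seminorm ℝ (Fin m ⊕ Fin m → ℝ)} (hNP : ∀ y, N y ^ 2 = y ⬝ᵥ (P₁ *ᵥ y)) {C : ℝ}
    (hNC : ∀ y, N y ≤ C * ‖y‖) :
    ∃ ρ, 0 ≤ ρ ∧ ρ < 1 ∧ ∀ ν ∈ Icc T₁ T₂, ∀ y,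
      N ((1 + expInt h ν • Af2 m h) *ᵥ (Ag2 γ Lbar *ᵥ y)) ≤ ρ * N y := by
  have hNc : Continuous N := by
    refine Seminorm.continuous_of_le (q := (max C 0).toNNReal • normSeminorm ℝ _) ?_ fun y => ?_
    · exact (continuous_norm.const_smul ((max C 0).toNNReal : NNReal))
    · refine (hNC y).trans ?_
      change C * ‖y‖ ≤ ((max C 0).toNNReal : ℝ) * ‖y‖
      rw [Real.coe_toNNReal _ (le_max_right _ _)]
      gcongr
      exact le_max_left _ _
  refine N.exists_uniform_contraction hNc isCompact_Icc
    (fun ν => ((1 + expInt h ν • Af2 m h) * Ag2 γ Lbar).mulVecLin) ?_ (fun ν hν y hy => ?_)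
    |>.imp fun ρ hρ => ⟨hρ.1, hρ.2.1, fun ν hν y => by
      rw [mulVec_mulVec]; exact hρ.2.2 ν hν y⟩
  · have := continuous_expInt h
    simp only [mulVecLin_apply]
    refine Continuous.matrix_mulVec ?_ continuous_snd
    exact (continuous_const.add ((this.comp continuous_fst).smul continuous_const)).mul
      continuous_const
  · refine lt_of_pow_lt_pow_left₀ 2 (apply_nonneg N _) ?_
    have hpos := (hJump ν hν).dotProduct_mulVec_pos hy
    rw [star_trivial, jumpQ, flowP, ← transpose_smul, Matrix.exp_transpose, exp_smul_Af2] at hpos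
    rw [hNP, hNP]
    simp only [neg_sub, sub_mulVec, dotProduct_sub, ← mulVec_mulVec, mulVecLin_apply] at hpos ⊢
    simp only [dotProduct_mulVec _ (transpose _), vecMul_transpose] at hpos
    linarith

end HyNTP

namespace HyNTP

open Matrix

/-! ### The flow of the closed loop -/

section Flow

variable {n : ℕ}

theorem State.mk_add (e u η τs ahat τhat e' u' η' τs' ahat' τhat' : Fin n → ℝ) (τ τ' : ℝ) :
    State.mk (e + e') (u + u') (η + η') (τs + τs') (ahat + ahat') (τhat + τhat') (τ + τ') =
      State.mk e u η τs ahat τhat τ + State.mk e' u' η' τs' ahat' τhat' τ' := by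
  ext (⟨k, i⟩ | _)
  · fin_cases k <;> rfl
  · rfl

theorem State.mk_smul (r : ℝ) (e u η τs ahat τhat : Fin n → ℝ) (τ : ℝ) :
    State.mk (r • e) (r • u) (r • η) (r • τs) (r • ahat) (r • τhat) (r * τ) =
      r • State.mk e u η τs ahat τhat τ := by
  ext (⟨k, i⟩ | _)
  · fin_cases k <;> rfl
  · rfl

/-- The linear part of the flow map. -/
def flowLin (n : ℕ) (μ h : ℝ) : State n →L[ℝ] State n :=
  LinearMap.toContinuousLinearMap
    { toFun := fun x => State.mk x.u (h • x.η - μ • (x.τhat - x.τs)) (h • x.η) 0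
        (-μ • (x.τhat - x.τs)) (x.ahat - (x.τhat - x.τs)) 0
      map_add' := fun x y => by
        rw [← State.mk_add]
        congr 1 <;> first
          | simp; done
          | ext i; simp [State.η, State.τhat, State.τs, State.ahat]; try ring
      map_smul' := fun r x => by
        rw [RingHom.id_apply, ← State.mk_smul]
        congr 1 <;> first
          | simp; done
          | ext i; simp [State.η, State.τhat, State.τs, State.ahat]; try ring }

/-- A global solution of the differential equation `x' = f x` of the closed loop, without the
constraint `x ∈ C`; its right-hand side does not involve the graph or the jump parameters. -/
def IsFlowCurve (a : Fin n → ℝ) (σ μ h : ℝ) (c : ℝ → State n) : Prop :=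
  ∀ t, HasDerivAt c (flowLin n μ h (c t) + State.mk (fun i => a i - σ) 0 0 a 0 0 (-1)) t

theorem closedLoop_f (𝒢 : Digraph (Fin n)) (a : Fin n → ℝ) (σ T₁ T₂ μ h γ : ℝ) (x : State n) :
    (closedLoop 𝒢 a σ T₁ T₂ μ h γ).f x =
      flowLin n μ h x + State.mk (fun i => a i - σ) 0 0 a 0 0 (-1) := by
  change _ = State.mk _ _ _ _ _ _ _ + _
  rw [← State.mk_add]
  simp only [closedLoop]
  congr 1 <;> first
    | simp; done
    | ext i; simp; try ring

theorem exists_isFlowCurve (a : Fin n → ℝ) (σ μ h : ℝ) (x : State n) :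
    ∃ c, IsFlowCurve a σ μ h c ∧ c 0 = x :=
  let ⟨c, h0, hc⟩ := exists_hasDerivAt_affine (flowLin n μ h) _ x
  ⟨c, hc, h0⟩

theorem IsFlowCurve.comp_sub_const {a : Fin n → ℝ} {σ μ h : ℝ} {c : ℝ → State n}
    (hc : IsFlowCurve a σ μ h c) (s : ℝ) : IsFlowCurve a σ μ h fun t => c (t - s) := fun t =>
  (hc (t - s)).comp_sub_const t s

theorem lipschitzWith_flowLin_add (μ h : ℝ) (w : State n) :
    LipschitzWith ‖flowLin n μ h‖₊ fun x => flowLin n μ h x + w := by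
  refine LipschitzWith.of_dist_le_mul fun x y => ?_
  rw [dist_add_right]
  exact (flowLin n μ h).lipschitz.dist_le_mul x y

end Flow

/-! ### Error coordinates -/

section Coordinates

variable {n : ℕ}

/-- The drift estimation error `a - â`. -/
def driftErr (a : Fin n → ℝ) (x : State n) : Fin n → ℝ := a - x.ahat

/-- The clock estimation error `τ̂ - τ*`. -/
def clockErr (x : State n) : Fin n → ℝ := x.τhat - x.τs

/-- The deviation of `u` from its value `η - â + σ` on the synchronization set. -/
def inputErr (σ : ℝ) (x : State n) : Fin n → ℝ := fun i => x.u i - x.η i + x.ahat i - σ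

/-- The three errors that evolve autonomously along flows. -/
def estErr (a : Fin n → ℝ) (σ : ℝ) (x : State n) : (Fin n → ℝ) × (Fin n → ℝ) × (Fin n → ℝ) :=
  (driftErr a x, clockErr x, inputErr σ x)

/-- The images of `e` and `η` under a matrix `R`, below the projection along the consensus
direction. -/
def modal {m : ℕ} (R : Matrix (Fin m) (Fin n) ℝ) (x : State n) : Fin m ⊕ Fin m → ℝ :=
  Sum.elim (R *ᵥ x.e) (R *ᵥ x.η)

theorem hasDerivAt_coord {c : ℝ → State n} {c' : State n} {t : ℝ} (hc : HasDerivAt c c' t)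
    (k : (Fin 6 × Fin n) ⊕ Unit) : HasDerivAt (fun r => c r k) (c' k) t :=
  (EuclideanSpace.proj (𝕜 := ℝ) k).hasFDerivAt.comp_hasDerivAt t hc

namespace IsFlowCurve

variable {a : Fin n → ℝ} {σ μ h : ℝ} {c : ℝ → State n}

theorem hasDerivAt_timer (hc : IsFlowCurve a σ μ h c) (t : ℝ) :
    HasDerivAt (fun r => (c r).timer) (-1) t :=
  (hasDerivAt_coord (hc t) (Sum.inr ())).congr_deriv (by simp [flowLin, State.mk])

theorem hasDerivAt_τs (hc : IsFlowCurve a σ μ h c) (t : ℝ) :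
    HasDerivAt (fun r => (c r).τs) a t :=
  hasDerivAt_pi.2 fun i => (hasDerivAt_coord (hc t) (Sum.inl (3, i))).congr_deriv
    (by simp [flowLin, State.mk])

theorem hasDerivAt_e (hc : IsFlowCurve a σ μ h c) (t : ℝ) :
    HasDerivAt (fun r => (c r).e)
      ((c t).η + (driftErr a (c t) + inputErr σ (c t))) t :=
  hasDerivAt_pi.2 fun i => (hasDerivAt_coord (hc t) (Sum.inl (0, i))).congr_deriv
    (by simp [flowLin, State.mk, driftErr, inputErr]; ring)

theorem hasDerivAt_η (hc : IsFlowCurve a σ μ h c) (t : ℝ) :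
    HasDerivAt (fun r => (c r).η) (h • (c t).η) t :=
  hasDerivAt_pi.2 fun i => (hasDerivAt_coord (hc t) (Sum.inl (2, i))).congr_deriv
    (by simp [flowLin, State.mk])

theorem hasDerivAt_driftErr (hc : IsFlowCurve a σ μ h c) (t : ℝ) :
    HasDerivAt (fun r => driftErr a (c r)) (μ • clockErr (c t)) t :=
  hasDerivAt_pi.2 fun i => ((hasDerivAt_coord (hc t) (Sum.inl (4, i))).const_sub (a i)).congr_deriv
    (by simp [flowLin, State.mk, clockErr])

theorem hasDerivAt_clockErr (hc : IsFlowCurve a σ μ h c) (t : ℝ) :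
    HasDerivAt (fun r => clockErr (c r)) (-driftErr a (c t) - clockErr (c t)) t :=
  hasDerivAt_pi.2 fun i => ((hasDerivAt_coord (hc t) (Sum.inl (5, i))).sub
    (hasDerivAt_coord (hc t) (Sum.inl (3, i)))).congr_deriv
    (by simp [flowLin, State.mk, clockErr, driftErr]; ring)

theorem hasDerivAt_inputErr (hc : IsFlowCurve a σ μ h c) (t : ℝ) :
    HasDerivAt (fun r => inputErr σ (c r)) (-(2 * μ) • clockErr (c t)) t :=
  hasDerivAt_pi.2 fun i => ((((hasDerivAt_coord (hc t) (Sum.inl (1, i))).sub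
    (hasDerivAt_coord (hc t) (Sum.inl (2, i)))).add
    (hasDerivAt_coord (hc t) (Sum.inl (4, i)))).sub_const σ).congr_deriv
    (by simp [flowLin, State.mk, clockErr]; ring)

theorem timer_eq (hc : IsFlowCurve a σ μ h c) (t : ℝ) : (c t).timer = (c 0).timer - t := by
  have hd : ∀ r, HasDerivAt (fun r => (c r).timer + r) 0 r := fun r =>
    ((hc.hasDerivAt_timer r).add (hasDerivAt_id r)).congr_deriv (by simp)
  have := is_const_of_deriv_eq_zero (fun r => (hd r).differentiableAt) (fun r => (hd r).deriv) t 0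
  simp only [add_zero] at this
  linarith

theorem τs_eq (hc : IsFlowCurve a σ μ h c) (t : ℝ) : (c t).τs = (c 0).τs + t • a := by
  have hd : ∀ r, HasDerivAt (fun r => (c r).τs - r • a) 0 r := fun r =>
    ((hc.hasDerivAt_τs r).sub ((hasDerivAt_id r).smul_const a)).congr_deriv (by simp)
  have := is_const_of_deriv_eq_zero (fun r => (hd r).differentiableAt) (fun r => (hd r).deriv) t 0
  simp only [zero_smul, sub_zero] at this
  rw [← this]; abel

theorem η_eq (hc : IsFlowCurve a σ μ h c) (t : ℝ) : (c t).η = Real.exp (h * t) • (c 0).η := by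
  have hd : ∀ r, HasDerivAt (fun r => Real.exp (h * -r) • (c r).η) 0 r := fun r => by
    have h1 : HasDerivAt (fun r : ℝ => Real.exp (h * -r)) (Real.exp (h * -r) * (h * -1)) r :=
      (((hasDerivAt_id r).neg).const_mul h).exp
    refine (h1.smul (hc.hasDerivAt_η r)).congr_deriv ?_
    rw [smul_smul, ← add_smul]
    simp
  have := is_const_of_deriv_eq_zero (fun r => (hd r).differentiableAt) (fun r => (hd r).deriv) t 0
  simp only [neg_zero, mul_zero, Real.exp_zero, one_smul] at this
  rw [← this, smul_smul, ← Real.exp_add]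
  simp

theorem norm_estErr_le (hc : IsFlowCurve a σ μ h c) (hμ : 0 < μ) {t : ℝ} (ht : 0 ≤ t) :
    ‖estErr a σ (c t)‖ ≤ Real.exp ((2 * μ + 2) * t) * ‖estErr a σ (c 0)‖ := by
  have hd : ∀ r, HasDerivAt (fun r => estErr a σ (c r))
      (μ • clockErr (c r), -driftErr a (c r) - clockErr (c r), -(2 * μ) • clockErr (c r)) r :=
    fun r => (hc.hasDerivAt_driftErr r).prodMk
      ((hc.hasDerivAt_clockErr r).prodMk (hc.hasDerivAt_inputErr r))
  have := norm_le_gronwallBound_of_norm_deriv_right_le (K := 2 * μ + 2) (ε := 0) (a := 0) (b := t)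
    (fun r _ => (hd r).continuousAt.continuousWithinAt) (fun r _ => (hd r).hasDerivWithinAt)
    le_rfl (fun r _ => ?_) t ⟨ht, le_rfl⟩
  · rwa [gronwallBound_ε0, sub_zero, mul_comm] at this
  · have h1 : ‖driftErr a (c r)‖ ≤ ‖estErr a σ (c r)‖ := norm_fst_le (estErr a σ (c r))
    have h2 : ‖clockErr (c r)‖ ≤ ‖estErr a σ (c r)‖ :=
      (norm_fst_le (clockErr (c r), inputErr σ (c r))).trans (norm_snd_le (estErr a σ (c r)))
    have h0 : 0 ≤ ‖estErr a σ (c r)‖ := norm_nonneg _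
    rw [add_zero]
    refine max_le ?_ (max_le ?_ ?_)
    · change ‖μ • clockErr (c r)‖ ≤ _
      rw [norm_smul, Real.norm_of_nonneg hμ.le]
      nlinarith
    · change ‖-driftErr a (c r) - clockErr (c r)‖ ≤ _
      refine (norm_sub_le _ _).trans ?_
      rw [norm_neg]
      nlinarith
    · change ‖-(2 * μ) • clockErr (c r)‖ ≤ _
      rw [norm_smul, norm_neg, Real.norm_of_nonneg (by positivity)]
      nlinarith

end IsFlowCurve

/-- On bounded time intervals the modal coordinates follow `exp (t A_{f₂})` up to a perturbation
that is bounded by the initial estimation errors. -/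
theorem exists_norm_modal_sub_le {m : ℕ} (R : Matrix (Fin m) (Fin n) ℝ) (a : Fin n → ℝ)
    (σ h : ℝ) {μ : ℝ} (hμ : 0 < μ) (T₂ : ℝ) :
    ∃ C > 0, ∀ c, IsFlowCurve a σ μ h c → ∀ t ∈ Icc 0 T₂,
      ‖modal R (c t) - (1 + expInt h t • Af2 m h) *ᵥ modal R (c 0)‖ ≤ C * ‖estErr a σ (c 0)‖ := by
  obtain ⟨K, hK, hR⟩ := R.exists_norm_mulVec_le
  refine ⟨K * (2 * Real.exp ((2 * μ + 2) * T₂)) * (|T₂| + 1), by positivity,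
    fun c hc t ht => ?_⟩
  set E := ‖estErr a σ (c 0)‖
  have hE : 0 ≤ E := norm_nonneg _
  let δ : ℝ → Fin m → ℝ := fun r => R *ᵥ (c r).e - R *ᵥ (c 0).e - expInt h r • R *ᵥ (c 0).η
  have hδ : ∀ r, HasDerivAt δ (R *ᵥ (driftErr a (c r) + inputErr σ (c r))) r := fun r => by
    have h1 : HasDerivAt (fun r => R *ᵥ (c r).e) _ r :=
      (R.mulVecLin.toContinuousLinearMap).hasFDerivAt.comp_hasDerivAt r (hc.hasDerivAt_e r)
    refine ((h1.sub_const _).sub ((hasDerivAt_expInt h r).smul_const _)).congr_deriv ?_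
    change R *ᵥ _ - _ = _
    rw [mulVec_add, hc.η_eq r, mulVec_smul]
    abel
  have hδ0 : δ 0 = 0 := by simp [δ, expInt_zero]
  have hbound : ∀ r ∈ Ico 0 t, ‖R *ᵥ (driftErr a (c r) + inputErr σ (c r))‖ ≤
      K * (2 * Real.exp ((2 * μ + 2) * T₂)) * E := fun r hr => by
    have h0 := hc.norm_estErr_le hμ hr.1
    have h1 : ‖driftErr a (c r)‖ ≤ ‖estErr a σ (c r)‖ := norm_fst_le (estErr a σ (c r))
    have h2 : ‖inputErr σ (c r)‖ ≤ ‖estErr a σ (c r)‖ :=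
      (norm_snd_le (clockErr (c r), inputErr σ (c r))).trans (norm_snd_le (estErr a σ (c r)))
    have h3 : Real.exp ((2 * μ + 2) * r) ≤ Real.exp ((2 * μ + 2) * T₂) := by
      gcongr
      exact hr.2.le.trans ht.2
    calc _ ≤ K * ‖driftErr a (c r) + inputErr σ (c r)‖ := hR _
      _ ≤ K * (‖estErr a σ (c r)‖ + ‖estErr a σ (c r)‖) := by
        gcongr
        exact (norm_add_le _ _).trans (add_le_add h1 h2)
      _ ≤ K * (Real.exp ((2 * μ + 2) * T₂) * E + Real.exp ((2 * μ + 2) * T₂) * E) := by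
        have := h0.trans (mul_le_mul_of_nonneg_right h3 hE)
        gcongr
      _ = _ := by ring
  have hmv := norm_image_sub_le_of_norm_deriv_le_segment' (f := δ) (a := 0) (b := t)
    (fun r _ => (hδ r).hasDerivWithinAt) hbound t ⟨ht.1, le_rfl⟩
  rw [hδ0, sub_zero, sub_zero] at hmv
  have heq : modal R (c t) - (1 + expInt h t • Af2 m h) *ᵥ modal R (c 0) = Sum.elim (δ t) 0 := by
    rw [modal, modal, one_add_smul_Af2_mulVec, hc.η_eq t, mulVec_smul, mul_comm _ h, mul_expInt]
    ext (i | i)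
    · simp [δ]; ring
    · simp; ring
  rw [heq, pi_norm_le_iff_of_nonneg (by positivity)]
  have hδt : ‖δ t‖ ≤ K * (2 * Real.exp ((2 * μ + 2) * T₂)) * (|T₂| + 1) * E := by
    refine hmv.trans ?_
    have : t ≤ |T₂| + 1 := ht.2.trans ((le_abs_self _).trans (by linarith))
    calc _ ≤ K * (2 * Real.exp ((2 * μ + 2) * T₂)) * E * (|T₂| + 1) := by gcongr
      _ = _ := by ring
  rintro (i | i)
  · exact (norm_le_pi_norm (δ t) i).trans hδt
  · simp only [Sum.elim_inr, Pi.zero_apply, norm_zero]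
    positivity

/-- The Lyapunov inequality for `P₂` makes the estimation errors of each node decay
exponentially. -/
theorem exists_estimation_decay {P₂ : Matrix (Fin 2) (Fin 2) ℝ} {μ β₁ : ℝ} (hβ₁ : 0 < β₁)
    (hLyap : (-(β₁ • (1 : Matrix (Fin 2) (Fin 2) ℝ)) -
      (P₂ * Af3 μ + (Af3 μ).transpose * P₂)).PosSemidef)
    {N : Seminorm ℝ (Fin 2 → ℝ)} (hNP : ∀ y, N y ^ 2 = y ⬝ᵥ (P₂ *ᵥ y)) {C : ℝ} (hC : 0 < C)
    (hNC : ∀ y, N y ≤ C * ‖y‖) (a : Fin n → ℝ) (σ h : ℝ) :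
    ∃ k > 0, ∀ c, IsFlowCurve a σ μ h c → ∀ i, ∀ t ≥ 0,
      N ![driftErr a (c t) i, clockErr (c t) i] ≤
        Real.exp (-k * t) * N ![driftErr a (c 0) i, clockErr (c 0) i] := by
  refine ⟨β₁ / C ^ 2 / 2, by positivity, fun c hc i t ht => ?_⟩
  set k := β₁ / C ^ 2 / 2 with hk
  set V : ℝ → ℝ := fun r => N ![driftErr a (c r) i, clockErr (c r) i] ^ 2 with hV
  have hVeq : V = fun r => P₂ 0 0 * (driftErr a (c r) i * driftErr a (c r) i) +
      (P₂ 0 1 + P₂ 1 0) * (driftErr a (c r) i * clockErr (c r) i) +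
      P₂ 1 1 * (clockErr (c r) i * clockErr (c r) i) := by
    ext r
    simp only [hV, hNP, dotProduct, mulVec, Fin.sum_univ_two, cons_val_zero, cons_val_one]
    ring
  have hVd : ∀ r, ∃ V' ≤ -(2 * k) * V r, HasDerivAt V V' r := fun r => by
    have hx := hasDerivAt_pi.1 (hc.hasDerivAt_driftErr r) i
    have hy := hasDerivAt_pi.1 (hc.hasDerivAt_clockErr r) i
    have hd := (((hx.mul hx).const_mul (P₂ 0 0)).add
      ((hx.mul hy).const_mul (P₂ 0 1 + P₂ 1 0))).add ((hy.mul hy).const_mul (P₂ 1 1))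
    refine ⟨_, ?_, by rw [hVeq]; exact hd⟩
    have hpsd := hLyap.dotProduct_mulVec_nonneg ![driftErr a (c r) i, clockErr (c r) i]
    rw [star_trivial] at hpsd
    have hn : ‖![driftErr a (c r) i, clockErr (c r) i]‖ ^ 2 ≤
        driftErr a (c r) i ^ 2 + clockErr (c r) i ^ 2 := by
      refine (sq_le_sq₀ (norm_nonneg _) (Real.sqrt_nonneg
        (driftErr a (c r) i ^ 2 + clockErr (c r) i ^ 2))).2 ?_ |>.trans
        (Real.sq_sqrt (by positivity)).le
      rw [pi_norm_le_iff_of_nonneg (Real.sqrt_nonneg _)]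
      intro j
      fin_cases j
      · exact Real.abs_le_sqrt (by simp; positivity)
      · exact Real.abs_le_sqrt (by simp; positivity)
    have hVn : V r ≤ C ^ 2 * (driftErr a (c r) i ^ 2 + clockErr (c r) i ^ 2) :=
      calc V r ≤ (C * ‖![driftErr a (c r) i, clockErr (c r) i]‖) ^ 2 :=
            pow_le_pow_left₀ (apply_nonneg N _) (hNC _) 2
        _ ≤ _ := by rw [mul_pow]; gcongr
    have h2k : 2 * k * V r ≤ β₁ * (driftErr a (c r) i ^ 2 + clockErr (c r) i ^ 2) := by
      calc 2 * k * V r ≤ 2 * k * (C ^ 2 * (driftErr a (c r) i ^ 2 + clockErr (c r) i ^ 2)) := by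
            gcongr
        _ = _ := by rw [hk]; field_simp
    simp [Af3, dotProduct, mulVec, Fin.sum_univ_two, Matrix.mul_apply, Matrix.one_apply] at hpsd
    simp only [Pi.smul_apply, Pi.sub_apply, Pi.neg_apply, smul_eq_mul]
    nlinarith
  have hanti : Antitone fun r => Real.exp (2 * k * r) * V r := by
    choose V' hV' hd using hVd
    have hd' : ∀ r, HasDerivAt (fun r => Real.exp (2 * k * r) * V r)
        (Real.exp (2 * k * r) * (2 * k * V r + V' r)) r := fun r => by
      have h1 : HasDerivAt (fun r : ℝ => Real.exp (2 * k * r))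
          (Real.exp (2 * k * r) * (2 * k * 1)) r := ((hasDerivAt_id r).const_mul (2 * k)).exp
      exact (h1.mul (hd r)).congr_deriv (by ring)
    refine antitone_of_deriv_nonpos (fun r => (hd' r).differentiableAt) fun r => ?_
    rw [(hd' r).deriv]
    exact mul_nonpos_of_nonneg_of_nonpos (Real.exp_nonneg _) (by linarith [hV' r])
  have h0 := hanti ht
  simp only [mul_zero, Real.exp_zero, one_mul] at h0
  refine le_of_sq_le_sq ?_ (mul_nonneg (Real.exp_nonneg _) (apply_nonneg N _))
  rw [mul_pow, ← Real.exp_nat_mul]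
  have h1 : Real.exp (2 * k * t) * Real.exp (((2 : ℕ) : ℝ) * (-k * t)) = 1 := by
    rw [← Real.exp_add, Real.exp_eq_one_iff]; push_cast; ring
  calc V t = Real.exp (((2 : ℕ) : ℝ) * (-k * t)) * (Real.exp (2 * k * t) * V t) := by
        rw [← mul_assoc, mul_comm (Real.exp _) (Real.exp (2 * k * t)), h1, one_mul]
    _ ≤ _ := by gcongr

end Coordinates
end HyNTP

namespace HyNTP

open Matrix

/-! ### The consensus direction -/

/-- The block form in terms of the lower rows `R` of `T⁻¹` and the right columns `U` of `T`:
`R` kills exactly the consensus vectors and intertwines the Laplacian with `Lbar`. -/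
theorem IsBlockForm.exists_factorization {m : ℕ} {L T : Matrix (Fin (m + 1)) (Fin (m + 1)) ℝ}
    {Lbar : Matrix (Fin m) (Fin m) ℝ} (hT : IsBlockForm L T Lbar) :
    ∃ (R : Matrix (Fin m) (Fin (m + 1)) ℝ) (U : Matrix (Fin (m + 1)) (Fin m) ℝ),
      (∀ v, R *ᵥ (L *ᵥ v) = Lbar *ᵥ (R *ᵥ v)) ∧ (∀ v, L *ᵥ v = U *ᵥ (Lbar *ᵥ (R *ᵥ v))) ∧
      (∀ v, (∀ i k, v i = v k) → R *ᵥ v = 0) ∧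
      ∀ v, ∃ s : ℝ, v = (fun _ => s) + U *ᵥ (R *ᵥ v) := by
  have hTT : T * T⁻¹ = 1 := mul_nonsing_inv T hT.nonsingular
  have hTT' : T⁻¹ * T = 1 := nonsing_inv_mul T hT.nonsingular
  let R : Matrix (Fin m) (Fin (m + 1)) ℝ := of fun i k => T⁻¹ i.succ k
  let U : Matrix (Fin (m + 1)) (Fin m) ℝ := of fun i k => T i k.succ
  have hR : ∀ v i, (R *ᵥ v) i = (T⁻¹ *ᵥ v) i.succ := fun v i => rfl
  -- `T *ᵥ v` splits off the contribution of the consensus direction.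
  have hU : ∀ v, T *ᵥ v = (fun _ => 1 / Real.sqrt ((m + 1 : ℕ) : ℝ) * v 0) +
      U *ᵥ fun i => v i.succ := fun v => by
    ext i
    simp only [mulVec, dotProduct, Fin.sum_univ_succ, Pi.add_apply, hT.first_col]
    rfl
  have hdec : ∀ v, v = (fun _ => 1 / Real.sqrt ((m + 1 : ℕ) : ℝ) * (T⁻¹ *ᵥ v) 0) +
      U *ᵥ (R *ᵥ v) := fun v => by
    have := hU (T⁻¹ *ᵥ v)
    rw [mulVec_mulVec, hTT, one_mulVec] at this
    exact this
  have hL : ∀ v, T⁻¹ *ᵥ (L *ᵥ v) = Fin.cons 0 (Lbar *ᵥ (R *ᵥ v)) := fun v => by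
    have h1 : T⁻¹ *ᵥ (L *ᵥ v) = (T⁻¹ * L * T) *ᵥ (T⁻¹ *ᵥ v) := by
      rw [mulVec_mulVec, mulVec_mulVec, mul_assoc (T⁻¹ * L), hTT, mul_one]
    rw [h1, hT.conj_eq]
    ext i
    refine Fin.cases ?_ (fun i => ?_) i
    · simp [mulVec, dotProduct, vecCons]
    · rw [Fin.cons_succ]
      change (Fin.cons 0 (Lbar i) : Fin (m + 1) → ℝ) ⬝ᵥ (T⁻¹ *ᵥ v) = Lbar i ⬝ᵥ (R *ᵥ v)
      simp only [dotProduct, Fin.sum_univ_succ, Fin.cons_zero, Fin.cons_succ, zero_mul, zero_add,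
        hR]
  refine ⟨R, U, fun v => ?_, fun v => ?_, fun v hv => ?_, fun v => ⟨_, hdec v⟩⟩
  · ext i
    rw [hR, hL, Fin.cons_succ]
  · have := hdec (L *ᵥ v)
    rw [hL] at this
    conv_lhs => rw [this]
    have h2 : R *ᵥ (L *ᵥ v) = Lbar *ᵥ (R *ᵥ v) := by ext i; rw [hR, hL, Fin.cons_succ]
    rw [h2]
    ext i
    simp
  · -- A consensus vector is a multiple of the first column of `T`.
    have hs : Real.sqrt ((m + 1 : ℕ) : ℝ) ≠ 0 := by positivity
    have hv' : v = T *ᵥ (Pi.single 0 (v 0 * Real.sqrt ((m + 1 : ℕ) : ℝ))) := by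
      ext i
      rw [mulVec_single]
      simp only [Pi.smul_apply, col_apply, hT.first_col, MulOpposite.smul_eq_mul_unop,
        MulOpposite.unop_op]
      rw [hv i 0]
      field_simp
    ext i
    rw [hR, hv', mulVec_mulVec, hTT', one_mulVec]
    simp

/-! ### Jumps -/

section Jumps

variable {m : ℕ} {𝒢 : Digraph (Fin (m + 1))} {a : Fin (m + 1) → ℝ} {σ T₁ T₂ μ h γ : ℝ}
  {x y : State (m + 1)}

theorem driftErr_jump (hy : y ∈ (closedLoop 𝒢 a σ T₁ T₂ μ h γ).G x) :
    driftErr a y = driftErr a x := by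
  obtain ⟨ν, -, rfl⟩ := hy
  rfl

theorem clockErr_jump (hy : y ∈ (closedLoop 𝒢 a σ T₁ T₂ μ h γ).G x) :
    clockErr y = clockErr x := by
  obtain ⟨ν, -, rfl⟩ := hy
  rfl

theorem inputErr_jump (hy : y ∈ (closedLoop 𝒢 a σ T₁ T₂ μ h γ).G x) : inputErr σ y = 0 := by
  obtain ⟨ν, -, rfl⟩ := hy
  ext i
  simp [inputErr, State.u, State.η, State.ahat, State.mk]
  ring

theorem e_jump (hy : y ∈ (closedLoop 𝒢 a σ T₁ T₂ μ h γ).G x) : y.e = x.e := by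
  obtain ⟨ν, -, rfl⟩ := hy
  rfl

theorem η_jump (hy : y ∈ (closedLoop 𝒢 a σ T₁ T₂ μ h γ).G x) :
    y.η = -γ • (𝒢.laplacian *ᵥ x.e) := by
  obtain ⟨ν, -, rfl⟩ := hy
  rfl

theorem modal_jump {R : Matrix (Fin m) (Fin (m + 1)) ℝ} {Lbar : Matrix (Fin m) (Fin m) ℝ}
    (hR : ∀ v, R *ᵥ (𝒢.laplacian *ᵥ v) = Lbar *ᵥ (R *ᵥ v))
    (hy : y ∈ (closedLoop 𝒢 a σ T₁ T₂ μ h γ).G x) :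
    modal R y = Ag2 γ Lbar *ᵥ modal R x := by
  rw [modal, modal, Ag2_mulVec, e_jump hy, η_jump hy, mulVec_smul, hR]

end Jumps

/-! ### The distance to the synchronization set -/

section Distance

variable {n : ℕ}

/-- A gauge of the distance to the synchronization set. -/
def errSize {m : ℕ} (R : Matrix (Fin m) (Fin n) ℝ) (a : Fin n → ℝ) (σ : ℝ) (x : State n) : ℝ :=
  ‖modal R x‖ + ‖x.η‖ + ‖estErr a σ x‖

theorem errSize_nonneg {m : ℕ} (R : Matrix (Fin m) (Fin n) ℝ) (a : Fin n → ℝ) (σ : ℝ)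
    (x : State n) : 0 ≤ errSize R a σ x := by
  unfold errSize; positivity

theorem syncSet_nonempty (a : Fin n → ℝ) (σ : ℝ) {T₂ : ℝ} (hT₂ : 0 ≤ T₂) :
    (syncSet a σ T₂).Nonempty := by
  refine ⟨State.mk 0 (fun i => -a i + σ) 0 0 a 0 0, ⟨fun i => ?_, ?_⟩, fun i k => ?_⟩
  · simp [State.τs, State.mk]
  · simpa [State.timer, State.mk] using hT₂
  · simp [State.e, State.η, State.ahat, State.τhat, State.τs, State.u, State.mk]

theorem isClosed_stateSpace (n : ℕ) (T₂ : ℝ) : IsClosed (stateSpace n T₂) := by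
  have hc : ∀ k : (Fin 6 × Fin n) ⊕ Unit, Continuous fun x : State n => x k := fun k =>
    (EuclideanSpace.proj (𝕜 := ℝ) k).continuous
  have h1 : IsClosed {x : State n | ∀ i, 0 ≤ x.τs i} := by
    simp only [ofPred_forall]
    exact isClosed_iInter fun i => isClosed_le continuous_const (hc _)
  exact h1.inter (isClosed_Icc.preimage (hc (Sum.inr ())))

theorem isClosed_syncSet (a : Fin n → ℝ) (σ T₂ : ℝ) : IsClosed (syncSet a σ T₂) := by
  have hc : ∀ k : (Fin 6 × Fin n) ⊕ Unit, Continuous fun x : State n => x k := fun k =>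
    (EuclideanSpace.proj (𝕜 := ℝ) k).continuous
  have he : ∀ i, Continuous fun x : State n => x.e i := fun i => hc _
  have hu : ∀ i, Continuous fun x : State n => x.u i := fun i => hc _
  have hη : ∀ i, Continuous fun x : State n => x.η i := fun i => hc _
  have hs : ∀ i, Continuous fun x : State n => x.τs i := fun i => hc _
  have ha : ∀ i, Continuous fun x : State n => x.ahat i := fun i => hc _
  have ht : ∀ i, Continuous fun x : State n => x.τhat i := fun i => hc _
  suffices IsClosed {x : State n | ∀ i k, x.e i = x.e k ∧ x.η i = 0 ∧ x.ahat i = a i ∧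
      x.τhat i = x.τs i ∧ x.u i = x.η i - x.ahat i + σ} from (isClosed_stateSpace n T₂).inter this
  simp only [ofPred_forall, ofPred_and]
  exact isClosed_iInter fun i => isClosed_iInter fun k => (isClosed_eq (he i) (he k)).inter
    ((isClosed_eq (hη i) continuous_const).inter ((isClosed_eq (ha i) continuous_const).inter
    ((isClosed_eq (ht i) (hs i)).inter
    (isClosed_eq (hu i) (((hη i).sub (ha i)).add continuous_const)))))

theorem abs_sub_le_dist (x y : State n) (k : (Fin 6 × Fin n) ⊕ Unit) : |x k - y k| ≤ dist x y := by
  rw [dist_eq_norm]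
  simpa using PiLp.norm_apply_le (x - y) k

theorem exists_errSize_le_infDist {m : ℕ} {R : Matrix (Fin m) (Fin n) ℝ}
    (hR : ∀ v, (∀ i k, v i = v k) → R *ᵥ v = 0) (a : Fin n → ℝ) (σ : ℝ) {T₂ : ℝ}
    (hT₂ : 0 ≤ T₂) :
    ∃ C > 0, ∀ x, errSize R a σ x ≤ C * Metric.infDist x (syncSet a σ T₂) := by
  obtain ⟨K, hK, hRK⟩ := R.exists_norm_mulVec_le
  refine ⟨2 * K + 6, by positivity, fun x => ?_⟩
  rw [← div_le_iff₀' (by positivity), Metric.le_infDist (syncSet_nonempty a σ hT₂)]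
  intro y hy
  rw [div_le_iff₀' (by positivity)]
  obtain ⟨-, hy⟩ := hy
  set d := dist x y with hd
  have hd0 : 0 ≤ d := dist_nonneg
  have hk := abs_sub_le_dist x y
  have hη : ‖x.η‖ ≤ d := (pi_norm_le_iff_of_nonneg hd0).2 fun i => by
    have h1 : |x.η i - y.η i| ≤ d := hk _
    rwa [(hy i i).2.1, sub_zero] at h1
  have he : ‖R *ᵥ x.e‖ ≤ K * d := by
    have h1 : R *ᵥ x.e = R *ᵥ (x.e - y.e) := by
      rw [mulVec_sub, hR y.e fun i k => (hy i k).1, sub_zero]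
    rw [h1]
    refine (hRK _).trans (mul_le_mul_of_nonneg_left ?_ hK.le)
    exact (pi_norm_le_iff_of_nonneg hd0).2 fun i => hk _
  have hmod : ‖modal R x‖ ≤ K * d := by
    refine (pi_norm_le_iff_of_nonneg (by positivity)).2 ?_
    rintro (i | i)
    · exact (norm_le_pi_norm (R *ᵥ x.e) i).trans he
    · exact (norm_le_pi_norm (R *ᵥ x.η) i).trans ((hRK _).trans (by gcongr))
  have hest : ‖estErr a σ x‖ ≤ 4 * d := by
    refine max_le ?_ (max_le ?_ ?_)
    · refine (pi_norm_le_iff_of_nonneg (by positivity)).2 fun i => ?_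
      have h1 : |x.ahat i - y.ahat i| ≤ d := hk _
      rw [(hy i i).2.2.1, abs_sub_comm] at h1
      change |a i - x.ahat i| ≤ _
      linarith
    · refine (pi_norm_le_iff_of_nonneg (by positivity)).2 fun i => ?_
      have h1 : |x.τhat i - y.τhat i| ≤ d := hk _
      have h2 : |x.τs i - y.τs i| ≤ d := hk _
      rw [(hy i i).2.2.2.1] at h1
      change |x.τhat i - x.τs i| ≤ _
      rw [abs_le] at *
      constructor <;> linarith
    · refine (pi_norm_le_iff_of_nonneg (by positivity)).2 fun i => ?_
      have h1 : |x.u i - y.u i| ≤ d := hk _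
      have h2 : |x.η i - y.η i| ≤ d := hk _
      have h3 : |x.ahat i - y.ahat i| ≤ d := hk _
      rw [(hy i i).2.2.2.2] at h1
      change |x.u i - x.η i + x.ahat i - σ| ≤ _
      rw [abs_le] at *
      constructor <;> linarith
  unfold errSize
  nlinarith

theorem exists_infDist_le_errSize {m : ℕ} {R : Matrix (Fin m) (Fin n) ℝ}
    {U : Matrix (Fin n) (Fin m) ℝ} (hU : ∀ v, ∃ s : ℝ, v = (fun _ => s) + U *ᵥ (R *ᵥ v))
    (a : Fin n → ℝ) (σ T₂ : ℝ) :
    ∃ C > 0, ∀ x ∈ stateSpace n T₂, Metric.infDist x (syncSet a σ T₂) ≤ C * errSize R a σ x := by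
  obtain ⟨K, hK, hUK⟩ := U.exists_norm_mulVec_le
  let g : ((Fin 6 × Fin n) ⊕ Unit → ℝ) →L[ℝ] State n :=
    (WithLp.linearEquiv 2 ℝ ((Fin 6 × Fin n) ⊕ Unit → ℝ)).symm.toLinearMap.toContinuousLinearMap
  refine ⟨(‖g‖ + 1) * (K + 3), by positivity, fun x hx => ?_⟩
  set S := errSize R a σ x with hS
  have hS0 : 0 ≤ S := errSize_nonneg R a σ x
  obtain ⟨s, hs⟩ := hU x.e
  let y : State n := State.mk (fun _ => s) (fun i => -a i + σ) 0 x.τs a x.τs x.timer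
  have hy : y ∈ syncSet a σ T₂ := by
    refine ⟨⟨fun i => hx.1 i, hx.2⟩, fun i k => ?_⟩
    simp [y, State.e, State.η, State.ahat, State.τhat, State.τs, State.u, State.mk]
  have hmod : ‖modal R x‖ ≤ S := by
    have := norm_nonneg x.η
    have := norm_nonneg (estErr a σ x)
    rw [hS]; unfold errSize; linarith
  have hη : ‖x.η‖ ≤ S := by
    have := norm_nonneg (modal R x)
    have := norm_nonneg (estErr a σ x)
    rw [hS]; unfold errSize; linarith
  have hest : ‖estErr a σ x‖ ≤ S := by
    have := norm_nonneg (modal R x)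
    have := norm_nonneg x.η
    rw [hS]; unfold errSize; linarith
  have hRe : ‖R *ᵥ x.e‖ ≤ S := (pi_norm_le_iff_of_nonneg hS0).2 fun i =>
    (norm_le_pi_norm (modal R x) (Sum.inl i)).trans hmod
  have h1 : ‖driftErr a x‖ ≤ S := (norm_fst_le (estErr a σ x)).trans hest
  have h2 : ‖clockErr x‖ ≤ S :=
    (norm_fst_le (clockErr x, inputErr σ x)).trans ((norm_snd_le (estErr a σ x)).trans hest)
  have h3 : ‖inputErr σ x‖ ≤ S :=
    (norm_snd_le (clockErr x, inputErr σ x)).trans ((norm_snd_le (estErr a σ x)).trans hest)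
  have hle : ∀ {v : Fin n → ℝ} {r : ℝ}, ‖v‖ ≤ r → ∀ i, |v i| ≤ r := fun {v r} hv i =>
    (norm_le_pi_norm v i).trans hv
  have hcoord : ‖(fun k => x k - y k : (Fin 6 × Fin n) ⊕ Unit → ℝ)‖ ≤ (K + 3) * S := by
    have hbig : ∀ {r : ℝ}, r ≤ 3 * S → r ≤ (K + 3) * S := fun hr => by nlinarith
    refine (pi_norm_le_iff_of_nonneg (by positivity)).2 ?_
    rintro (⟨k, i⟩ | u)
    · have hη' := hle hη i
      have h1' := hle h1 i
      have h2' := hle h2 i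
      have h3' := hle h3 i
      simp only [driftErr, clockErr, inputErr, Pi.sub_apply] at h1' h2' h3'
      fin_cases k
      · change |x.e i - s| ≤ _
        have h4 : x.e i - s = (U *ᵥ (R *ᵥ x.e)) i := by
          have := congrFun hs i
          simp only [Pi.add_apply] at this
          linarith
        rw [h4]
        refine (norm_le_pi_norm _ i).trans ((hUK _).trans ?_)
        nlinarith [norm_nonneg (R *ᵥ x.e)]
      · change |x.u i - (-a i + σ)| ≤ _
        refine hbig ?_
        rw [abs_le] at *
        constructor <;> linarith
      · change |x.η i - 0| ≤ _
        refine hbig ?_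
        rw [sub_zero]
        linarith
      · change |x.τs i - x.τs i| ≤ _
        rw [sub_self, abs_zero]
        positivity
      · change |x.ahat i - a i| ≤ _
        refine hbig ?_
        rw [abs_sub_comm]
        linarith
      · change |x.τhat i - x.τs i| ≤ _
        exact hbig (by linarith)
    · change |x.timer - x.timer| ≤ _
      rw [sub_self, abs_zero]
      positivity
  refine (Metric.infDist_le_dist_of_mem hy).trans ?_
  rw [dist_eq_norm]
  have hxy : x - y = g fun k => x k - y k := rfl
  rw [hxy]
  refine (g.le_opNorm _).trans ?_
  rw [mul_assoc]
  gcongr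
  linarith

end Distance
end HyNTP

namespace HyNTP

open Matrix

/-! ### Contraction from one jump to the next -/

section Lyapunov

variable {m : ℕ} {𝒢 : Digraph (Fin (m + 1))} {a : Fin (m + 1) → ℝ} {σ T₁ T₂ μ h γ : ℝ}
  {R : Matrix (Fin m) (Fin (m + 1)) ℝ}

/-- Along a flow of bounded duration the error grows at most by a constant factor. -/
theorem exists_errSize_flow_le (R : Matrix (Fin m) (Fin (m + 1)) ℝ) (a : Fin (m + 1) → ℝ)
    (σ h T₂ : ℝ) (hμ : 0 < μ) :
    ∃ C > 0, ∀ c, IsFlowCurve a σ μ h c → ∀ t ∈ Icc 0 T₂,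
      errSize R a σ (c t) ≤ C * errSize R a σ (c 0) := by
  obtain ⟨C₀, hC₀, hmod⟩ := exists_norm_modal_sub_le R a σ h hμ T₂
  obtain ⟨CA, hCA, hA⟩ := (Af2 m h).exists_norm_mulVec_le
  obtain ⟨B, hB⟩ := (isCompact_Icc (a := (0 : ℝ)) (b := T₂)).exists_bound_of_continuousOn
    (continuous_expInt h).continuousOn
  refine ⟨(1 + |B| * CA) + C₀ + Real.exp (|h| * T₂) + Real.exp ((2 * μ + 2) * T₂),
    by positivity, fun c hc t ht => ?_⟩
  have hη : ‖(c t).η‖ ≤ Real.exp (|h| * T₂) * ‖(c 0).η‖ := by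
    rw [hc.η_eq t, norm_smul, Real.norm_of_nonneg (Real.exp_nonneg _)]
    have : h * t ≤ |h| * T₂ := (mul_le_mul_of_nonneg_right (le_abs_self h) ht.1).trans
      (mul_le_mul_of_nonneg_left ht.2 (abs_nonneg h))
    gcongr
  have hest : ‖estErr a σ (c t)‖ ≤ Real.exp ((2 * μ + 2) * T₂) * ‖estErr a σ (c 0)‖ := by
    refine (hc.norm_estErr_le hμ ht.1).trans ?_
    have := ht.2
    gcongr
  have hy : ‖modal R (c t)‖ ≤ (1 + |B| * CA) * ‖modal R (c 0)‖ + C₀ * ‖estErr a σ (c 0)‖ := by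
    have h1 : ‖(1 + expInt h t • Af2 m h) *ᵥ modal R (c 0)‖ ≤
        (1 + |B| * CA) * ‖modal R (c 0)‖ := by
      rw [add_mulVec, one_mulVec, smul_mulVec]
      refine (norm_add_le _ _).trans ?_
      rw [norm_smul, add_mul, one_mul, mul_assoc]
      have := (hB t ht).trans (le_abs_self B)
      gcongr
      exact hA _
    have h2 := norm_sub_norm_le (modal R (c t)) ((1 + expInt h t • Af2 m h) *ᵥ modal R (c 0))
    linarith [hmod c hc t ht]
  have h1 := norm_nonneg (modal R (c 0))
  have h2 := norm_nonneg ((c 0).η)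
  have h3 := norm_nonneg (estErr a σ (c 0))
  have e1 := Real.exp_pos (|h| * T₂)
  have e2 := Real.exp_pos ((2 * μ + 2) * T₂)
  have e3 : 0 < 1 + |B| * CA := by positivity
  unfold errSize
  calc _ ≤ ((1 + |B| * CA) * ‖modal R (c 0)‖ + C₀ * ‖estErr a σ (c 0)‖) +
        Real.exp (|h| * T₂) * ‖(c 0).η‖ +
        Real.exp ((2 * μ + 2) * T₂) * ‖estErr a σ (c 0)‖ := by linarith
    _ ≤ _ := by
      generalize Real.exp (|h| * T₂) = r at *
      generalize Real.exp ((2 * μ + 2) * T₂) = q at *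
      generalize 1 + |B| * CA = p at *
      generalize ‖modal R (c 0)‖ = u at *
      generalize ‖(c 0).η‖ = v at *
      generalize ‖estErr a σ (c 0)‖ = w at *
      have : 0 ≤ p * v := by positivity
      have : 0 ≤ p * w := by positivity
      have : 0 ≤ C₀ * u := by positivity
      have : 0 ≤ C₀ * v := by positivity
      have : 0 ≤ r * u := by positivity
      have : 0 ≤ r * w := by positivity
      have : 0 ≤ q * u := by positivity
      have : 0 ≤ q * v := by positivity
      nlinarith

/-- A function that contracts by a fixed factor from the state before a jump to the state before
the next one. It is the norm of `P₁` of the modal coordinates, plus a large multiple of the norm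
of `P₂` of the estimation errors, which drive the modal coordinates but are not driven by them. -/
theorem exists_lyapunov {Lbar : Matrix (Fin m) (Fin m) ℝ} {U : Matrix (Fin (m + 1)) (Fin m) ℝ}
    (hRL : ∀ v, R *ᵥ (𝒢.laplacian *ᵥ v) = Lbar *ᵥ (R *ᵥ v))
    (hUL : ∀ v, 𝒢.laplacian *ᵥ v = U *ᵥ (Lbar *ᵥ (R *ᵥ v)))
    (hT₁ : 0 < T₁) (hμ : 0 < μ)
    {P₁ : Matrix (Fin m ⊕ Fin m) (Fin m ⊕ Fin m) ℝ} {P₂ : Matrix (Fin 2) (Fin 2) ℝ}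
    (hP₁ : P₁.PosDef) (hP₂ : P₂.PosDef)
    (hJump : ∀ ν ∈ Icc T₁ T₂, (-(jumpQ h γ Lbar P₁ ν)).PosDef) {β₁ : ℝ} (hβ₁ : 0 < β₁)
    (hLyap : (-(β₁ • (1 : Matrix (Fin 2) (Fin 2) ℝ)) -
      (P₂ * Af3 μ + (Af3 μ).transpose * P₂)).PosSemidef) :
    ∃ W : State (m + 1) → ℝ, (∃ C > 0, ∀ x, W x ≤ C * errSize R a σ x) ∧
      (∃ C > 0, ∀ x, ∀ y ∈ (closedLoop 𝒢 a σ T₁ T₂ μ h γ).G x, errSize R a σ y ≤ C * W x) ∧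
      ∃ ρ, 0 < ρ ∧ ρ < 1 ∧ ∀ x c, IsFlowCurve a σ μ h c →
        c 0 ∈ (closedLoop 𝒢 a σ T₁ T₂ μ h γ).G x → ∀ ν ∈ Icc T₁ T₂, W (c ν) ≤ ρ * W x := by
  obtain ⟨N₁, hN₁, C₁, hC₁, hN₁C, hCN₁⟩ := hP₁.exists_seminorm
  obtain ⟨N₂, hN₂, C₂, hC₂, hN₂C, hCN₂⟩ := hP₂.exists_seminorm
  obtain ⟨ρ₁, hρ₁0, hρ₁1, hρ₁⟩ := exists_contraction_of_jumpQ hJump hN₁ hN₁C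
  obtain ⟨k, hk, hdecay⟩ := exists_estimation_decay hβ₁ hLyap hN₂ hC₂ hN₂C a σ h
  obtain ⟨C₀, hC₀, hmod⟩ := exists_norm_modal_sub_le R a σ h hμ T₂
  let A : State (m + 1) → ℝ := fun x => ∑ i, N₂ ![driftErr a x i, clockErr x i]
  have hA0 : ∀ x, 0 ≤ A x := fun x => Finset.sum_nonneg fun i _ => apply_nonneg N₂ _
  have hAle : ∀ x i, N₂ ![driftErr a x i, clockErr x i] ≤ A x := fun x i =>
    Finset.single_le_sum (f := fun i => N₂ ![driftErr a x i, clockErr x i])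
      (fun i _ => apply_nonneg N₂ _) (Finset.mem_univ i)
  have hest : ∀ x, ∀ y ∈ (closedLoop 𝒢 a σ T₁ T₂ μ h γ).G x, ‖estErr a σ y‖ ≤ C₂ * A x := by
    intro x y hy
    have h0 : 0 ≤ C₂ * A x := mul_nonneg hC₂.le (hA0 x)
    have hpair : ∀ i, ‖![driftErr a x i, clockErr x i]‖ ≤ C₂ * A x := fun i =>
      (hCN₂ _).trans (mul_le_mul_of_nonneg_left (hAle x i) hC₂.le)
    refine max_le ?_ (max_le ?_ ?_)
    · refine (pi_norm_le_iff_of_nonneg h0).2 fun i => ?_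
      change ‖driftErr a y i‖ ≤ _
      rw [driftErr_jump hy]
      exact (norm_le_pi_norm ![driftErr a x i, clockErr x i] 0).trans (hpair i)
    · refine (pi_norm_le_iff_of_nonneg h0).2 fun i => ?_
      change ‖clockErr y i‖ ≤ _
      rw [clockErr_jump hy]
      exact (norm_le_pi_norm ![driftErr a x i, clockErr x i] 1).trans (hpair i)
    · change ‖inputErr σ y‖ ≤ _
      rw [inputErr_jump hy, norm_zero]
      exact h0
  have hAS : ∀ x, A x ≤ (m + 1) * C₂ * ‖estErr a σ x‖ := fun x => by
    have : ∀ i ∈ Finset.univ, N₂ ![driftErr a x i, clockErr x i] ≤ C₂ * ‖estErr a σ x‖ := by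
      intro i _
      refine (hN₂C _).trans (mul_le_mul_of_nonneg_left ?_ hC₂.le)
      refine (pi_norm_le_iff_of_nonneg (norm_nonneg _)).2 fun j => ?_
      fin_cases j
      · exact (norm_le_pi_norm (driftErr a x) i).trans (norm_fst_le (estErr a σ x))
      · exact (norm_le_pi_norm (clockErr x) i).trans
          ((norm_fst_le (clockErr x, inputErr σ x)).trans (norm_snd_le (estErr a σ x)))
    refine (Finset.sum_le_card_nsmul _ _ _ this).trans ?_
    simp [mul_assoc]
  set ρ₂ := Real.exp (-k * T₁) with hρ₂
  have hρ₂0 : 0 < ρ₂ := Real.exp_pos _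
  have hρ₂1 : ρ₂ < 1 := by
    rw [hρ₂, ← Real.exp_zero]; exact Real.exp_lt_exp.2 (by nlinarith)
  -- `K` is large enough for the decrease of `K * A` to absorb the perturbation of `N₁`.
  set D := C₁ * (C₀ * C₂) with hD
  have hD0 : 0 < D := by positivity
  set K := 2 * D / (1 - ρ₂) with hK
  have hK0 : 0 < K := div_pos (by positivity) (by linarith)
  have hKD : D + K * ρ₂ = K * ((1 + ρ₂) / 2) := by
    have : K * (1 - ρ₂) = 2 * D := div_mul_cancel₀ _ (by linarith)
    linarith
  have hN₁0 : ∀ x : State (m + 1), 0 ≤ N₁ (modal R x) := fun x => apply_nonneg N₁ _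
  refine ⟨fun x => N₁ (modal R x) + K * A x, ?_, ?_, max ρ₁ ((1 + ρ₂) / 2),
    lt_max_of_lt_right (by linarith), max_lt hρ₁1 (by linarith), ?_⟩
  · refine ⟨C₁ + K * ((m + 1) * C₂), by positivity, fun x => ?_⟩
    have h1 := hN₁C (modal R x)
    have h2 := mul_le_mul_of_nonneg_left (hAS x) hK0.le
    have h3 : ‖modal R x‖ ≤ errSize R a σ x := by
      unfold errSize; linarith [norm_nonneg x.η, norm_nonneg (estErr a σ x)]
    have h4 : ‖estErr a σ x‖ ≤ errSize R a σ x := by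
      unfold errSize; linarith [norm_nonneg x.η, norm_nonneg (modal R x)]
    calc _ ≤ C₁ * ‖modal R x‖ + K * ((m + 1) * C₂ * ‖estErr a σ x‖) := add_le_add h1 h2
      _ ≤ C₁ * errSize R a σ x + K * ((m + 1) * C₂ * errSize R a σ x) := by gcongr
      _ = _ := by ring
  · obtain ⟨CA, hCA, hA⟩ := (Ag2 γ Lbar).exists_norm_mulVec_le
    obtain ⟨CU, hCU, hU⟩ := (U * Lbar).exists_norm_mulVec_le
    refine ⟨(CA + |γ| * CU) * C₁ + C₂ / K, by positivity, fun x y hy => ?_⟩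
    have h1 : ‖modal R y‖ ≤ CA * ‖modal R x‖ := by rw [modal_jump hRL hy]; exact hA _
    have h2 : ‖y.η‖ ≤ |γ| * CU * ‖modal R x‖ := by
      have h3 : ‖R *ᵥ x.e‖ ≤ ‖modal R x‖ := (pi_norm_le_iff_of_nonneg (norm_nonneg _)).2 fun i =>
        norm_le_pi_norm (modal R x) (Sum.inl i)
      rw [η_jump hy, hUL, mulVec_mulVec, norm_smul, norm_neg, Real.norm_eq_abs, mul_assoc]
      refine mul_le_mul_of_nonneg_left ((hU _).trans ?_) (abs_nonneg γ)
      gcongr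
    have h3 := hest x y hy
    have h4 := hCN₁ (modal R x)
    have h5 := hA0 x
    have h6 := hN₁0 x
    have h7 : 0 ≤ (CA + |γ| * CU) * C₁ := by positivity
    unfold errSize
    calc _ ≤ (CA + |γ| * CU) * ‖modal R x‖ + C₂ * A x := by linarith
      _ ≤ (CA + |γ| * CU) * (C₁ * N₁ (modal R x)) + C₂ * A x := by gcongr
      _ = (CA + |γ| * CU) * C₁ * N₁ (modal R x) + C₂ / K * (K * A x) := by
        field_simp
      _ ≤ _ := by
        have h8 : 0 ≤ C₂ / K := by positivity
        have h9 := mul_nonneg h7 (mul_nonneg hK0.le h5)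
        have h10 := mul_nonneg h8 h6
        linarith
  · intro x c hc h0 ν hν
    have hAc : A (c ν) ≤ ρ₂ * A x := by
      simp only [A, Finset.mul_sum]
      refine Finset.sum_le_sum fun i _ => (hdecay c hc i ν (hT₁.le.trans hν.1)).trans ?_
      rw [driftErr_jump h0, clockErr_jump h0]
      refine mul_le_mul_of_nonneg_right ?_ (apply_nonneg N₂ _)
      exact Real.exp_le_exp.2 (by nlinarith [hν.1])
    have hNc : N₁ (modal R (c ν)) ≤ ρ₁ * N₁ (modal R x) + D * A x := by
      set z := (1 + expInt h ν • Af2 m h) *ᵥ modal R (c 0) with hz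
      have h1 : N₁ z ≤ ρ₁ * N₁ (modal R x) := by
        rw [hz, modal_jump hRL h0]; exact hρ₁ ν hν _
      have h2 : N₁ (modal R (c ν) - z) ≤ D * A x := by
        refine (hN₁C _).trans ?_
        rw [hD, mul_assoc, mul_assoc]
        refine mul_le_mul_of_nonneg_left ?_ hC₁.le
        exact (hmod c hc ν ⟨hT₁.le.trans hν.1, hν.2⟩).trans
          (mul_le_mul_of_nonneg_left (hest x _ h0) hC₀.le)
      have h3 := map_add_le_add N₁ z (modal R (c ν) - z)
      rw [add_sub_cancel] at h3
      linarith
    have h1 := hN₁0 x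
    have h2 := hA0 x
    calc _ ≤ (ρ₁ * N₁ (modal R x) + D * A x) + K * (ρ₂ * A x) :=
        add_le_add hNc (mul_le_mul_of_nonneg_left hAc hK0.le)
      _ = ρ₁ * N₁ (modal R x) + (1 + ρ₂) / 2 * (K * A x) := by linear_combination A x * hKD
      _ ≤ max ρ₁ ((1 + ρ₂) / 2) * N₁ (modal R x) + max ρ₁ ((1 + ρ₂) / 2) * (K * A x) := by
        gcongr
        · exact le_max_left _ _
        · exact le_max_right _ _
      _ = _ := by ring

end Lyapunov
end HyNTP

/-! ### Extension of solutions -/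

namespace HybridSystem.IsMaximalSolution

variable {E : Type*} [NormedAddCommGroup E] [NormedSpace ℝ E] {H : HybridSystem E}
  {φ : HybridArc E}

/-- A maximal solution does not stop at a point from which it can jump. -/
theorem jump_eq_empty (hφ : H.IsMaximalSolution φ) {T : ℝ} {J : ℕ} (hTJ : (T, J) ∈ φ.dom)
    (htop : ∀ p ∈ φ.dom, p.2 ≤ J) (hD : φ.val T J ∈ H.D) : H.G (φ.val T J) = ∅ := by
  by_contra hne
  obtain ⟨y, hy⟩ := nonempty_iff_ne_empty.2 hne
  obtain ⟨hsol, hmax⟩ := hφ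
  have hdom := φ.isHybridTimeDomain
  have hnot : ∀ r, (r, J + 1) ∉ φ.dom := fun r hr => by
    have := htop _ hr
    simp at this
  have hslice : ∀ j ≠ J + 1, slice (insert (T, J + 1) φ.dom) j = slice φ.dom j := by
    intro j hj
    ext r
    simp [slice, hj]
  have hslice' : slice (insert (T, J + 1) φ.dom) (J + 1) = {T} := by
    ext r
    simp [slice, hnot]
  let ψ : HybridArc E :=
    { dom := insert (T, J + 1) φ.dom
      val := fun r j => if j = J + 1 then y else φ.val r j
      isHybridTimeDomain := hdom.insert_jump hTJ htop
      locallyAC := fun j p q hpq hsub => by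
        by_cases hj : j = J + 1
        · simp only [if_pos hj]
          exact (LipschitzWith.const y).lipschitzOnWith.absolutelyContinuousOnInterval
        · simp only [if_neg hj]
          exact φ.locallyAC j p q hpq (hslice j hj ▸ hsub) }
  have hψ : ∀ r j, (r, j) ∈ φ.dom → ψ.val r j = φ.val r j := fun r j hr => by
    have : j ≠ J + 1 := by rintro rfl; exact hnot r hr
    simp [ψ, this]
  refine hmax ⟨ψ, ⟨?_, fun j r hr => ?_, fun j => ?_, fun r j h1 h2 => ?_⟩,
    ssubset_insert (hnot _), hψ⟩
  · rw [hψ 0 0 hdom.zero_mem]; exact hsol.init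
  · by_cases hj : j = J + 1
    · subst hj
      change r ∈ interior (slice (insert (T, J + 1) φ.dom) (J + 1)) at hr
      rw [hslice', interior_singleton] at hr
      exact hr.elim
    · change r ∈ interior (slice (insert (T, J + 1) φ.dom) j) at hr
      rw [hslice j hj] at hr
      simpa [ψ, hj] using hsol.flow_mem j r hr
  · by_cases hj : j = J + 1
    · subst hj
      change ∀ᵐ r, r ∈ interior (slice (insert (T, J + 1) φ.dom) (J + 1)) → _
      rw [hslice', interior_singleton]
      exact Filter.Eventually.of_forall fun r hr => hr.elim
    · change ∀ᵐ r, r ∈ interior (slice (insert (T, J + 1) φ.dom) j) → _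
      rw [hslice j hj]
      simpa [ψ, hj] using hsol.flow_deriv j
  · rcases h2 with h2 | h2
    · obtain ⟨rfl, h3⟩ := Prod.mk.inj h2
      obtain rfl : j = J := by omega
      have h4 : ψ.val r j = φ.val r j := hψ _ _ hTJ
      have h5 : ψ.val r (j + 1) = y := by simp [ψ]
      rw [h4, h5]
      exact ⟨hD, hy⟩
    · have h1' : (r, j) ∈ φ.dom := by
        refine h1.resolve_left fun h3 => ?_
        have h4 := (Prod.mk.inj h3).2
        have h5 := htop _ h2
        simp only at h5
        omega
      rw [hψ _ _ h1', hψ _ _ h2]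
      exact hsol.jump r j h1' h2

/-- A maximal solution follows a flow that prolongs its last slice for as long as this flow stays
in the flow set. -/
theorem mem_dom_of_flow (hφ : H.IsMaximalSolution φ) {t₀ t₁ : ℝ} {J : ℕ} (h01 : t₀ ≤ t₁)
    (ht₀ : (t₀, J) ∈ φ.dom) (hmin : ∀ r, (r, J) ∈ φ.dom → t₀ ≤ r)
    (htop : ∀ p ∈ φ.dom, p.2 ≤ J) (hprev : ∀ p ∈ φ.dom, p.2 < J → p.1 ≤ t₀) {c : ℝ → E}
    (hcC : ContDiff ℝ 1 c) (hc : ∀ t, HasDerivAt c (H.f (c t)) t)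
    (hC : ∀ t ∈ Icc t₀ t₁, c t ∈ H.C)
    (hφc : ∀ r, (r, J) ∈ φ.dom → r ≤ t₁ ∧ φ.val r J = c r) : (t₁, J) ∈ φ.dom := by
  by_contra hend
  obtain ⟨hsol, hmax⟩ := hφ
  have hdom := φ.isHybridTimeDomain
  have hunion : ∀ r, (r, J) ∈ φ.dom ∪ Icc t₀ t₁ ×ˢ {J} ↔ r ∈ Icc t₀ t₁ :=
    fun r => ⟨fun hr => hr.elim (fun hr => ⟨hmin r hr, (hφc r hr).1⟩) fun hr => hr.1,
      fun hr => Or.inr ⟨hr, rfl⟩⟩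
  have hslice : ∀ j ≠ J, slice (φ.dom ∪ Icc t₀ t₁ ×ˢ {J}) j = slice φ.dom j := by
    intro j hj
    ext r
    simp [slice, hj]
  have hslice' : slice (φ.dom ∪ Icc t₀ t₁ ×ˢ {J}) J = Icc t₀ t₁ := Set.ext hunion
  let ψ : HybridArc E :=
    { dom := φ.dom ∪ Icc t₀ t₁ ×ˢ {J}
      val := fun r j => if j = J then c r else φ.val r j
      isHybridTimeDomain := hdom.union_Icc ht₀ hmin htop hprev
      locallyAC := fun j p q hpq hsub => by
        by_cases hj : j = J
        · simp only [if_pos hj]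
          exact hcC.contDiffOn.absolutelyContinuousOnInterval
        · simp only [if_neg hj]
          exact φ.locallyAC j p q hpq (hslice j hj ▸ hsub) }
  have hψ : ∀ r j, (r, j) ∈ φ.dom → ψ.val r j = φ.val r j := fun r j hr => by
    by_cases hj : j = J
    · subst hj
      simp [ψ, (hφc r hr).2]
    · simp [ψ, hj]
  refine hmax ⟨ψ, ⟨?_, fun j r hr => ?_, fun j => ?_, fun r j h1 h2 => ?_⟩,
    ssubset_iff_subset_not_subset.2 ⟨subset_union_left, fun hss => hend (hss (Or.inr
      ⟨⟨h01, le_rfl⟩, rfl⟩))⟩, hψ⟩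
  · rw [hψ 0 0 hdom.zero_mem]; exact hsol.init
  · by_cases hj : j = J
    · subst hj
      change r ∈ interior (slice (φ.dom ∪ Icc t₀ t₁ ×ˢ {j}) j) at hr
      rw [hslice'] at hr
      simpa [ψ] using hC r (interior_subset hr)
    · change r ∈ interior (slice (φ.dom ∪ Icc t₀ t₁ ×ˢ {J}) j) at hr
      rw [hslice j hj] at hr
      simpa [ψ, hj] using hsol.flow_mem j r hr
  · by_cases hj : j = J
    · refine Filter.Eventually.of_forall fun r _ => ?_
      simp only [ψ, if_pos hj]
      exact hc r
    · have hold := hsol.flow_deriv j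
      rw [← hslice j hj] at hold
      simpa only [ψ, if_neg hj] using hold
  · -- All jumps are old, because no slice beyond the last one was added.
    have hjJ : j < J := by
      rcases h2 with h2 | h2
      · exact htop (r, j + 1) h2
      · have h3 : j + 1 = J := h2.2
        omega
    have hr₀ : ∀ i, (r, i) ∈ ψ.dom → i ≠ J → (r, i) ∈ φ.dom := fun i hi hiJ =>
      hi.resolve_right fun h3 => hiJ h3.2
    have h1' := hr₀ j h1 hjJ.ne
    have h2' : (r, j + 1) ∈ φ.dom := by
      by_cases hj1 : j + 1 = J
      · have h3 : r ∈ Icc t₀ t₁ := h2.elim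
          (fun h => (hunion r).1 (Or.inl (hj1 ▸ h))) fun h => h.1
        have h4 : r = t₀ := le_antisymm (hprev _ h1' hjJ) h3.1
        rw [h4, hj1]
        exact ht₀
      · exact hr₀ _ h2 hj1
    rw [hψ _ _ h1', hψ _ _ h2']
    exact hsol.jump r j h1' h2'

end HybridSystem.IsMaximalSolution

namespace HyNTP

open Matrix

/-! ### Solutions of the closed loop -/

section Solutions

variable {n : ℕ} {𝒢 : Digraph (Fin n)} {a : Fin n → ℝ} {σ T₁ T₂ μ h γ : ℝ}
  {φ : HybridArc (State n)}

/-- On each slice of its domain, a solution follows the flow. -/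
theorem eqOn_of_isSolution (hφ : (closedLoop 𝒢 a σ T₁ T₂ μ h γ).IsSolution φ) {j : ℕ} {r b : ℝ}
    (hrb : r ≤ b) (hsub : Icc r b ⊆ slice φ.dom j) {c : ℝ → State n} (hc : IsFlowCurve a σ μ h c)
    (h0 : c 0 = φ.val r j) : ∀ t ∈ Icc r b, φ.val t j = c (t - r) := by
  refine (φ.locallyAC j r b hrb hsub).eqOn_of_ae_hasDerivAt (lipschitzWith_flowLin_add μ h _) hrb
    ?_ (hc.comp_sub_const r) (by simp [h0])
  have hint : Ioo r b ⊆ interior (slice φ.dom j) :=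
    isOpen_Ioo.subset_interior_iff.2 (Ioo_subset_Icc_self.trans hsub)
  filter_upwards [hφ.flow_deriv j] with t ht htm
  rw [← closedLoop_f 𝒢 a σ T₁ T₂ μ h γ]
  exact ht (hint htm)

theorem timer_eq_of_isSolution (hφ : (closedLoop 𝒢 a σ T₁ T₂ μ h γ).IsSolution φ) {j : ℕ}
    {r b : ℝ} (hrb : r ≤ b) (hsub : Icc r b ⊆ slice φ.dom j) :
    ∀ t ∈ Icc r b, (φ.val t j).timer = (φ.val r j).timer - (t - r) := by
  obtain ⟨c, hc, h0⟩ := exists_isFlowCurve a σ μ h (φ.val r j)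
  intro t ht
  rw [eqOn_of_isSolution hφ hrb hsub hc h0 t ht, hc.timer_eq, h0]

/-- A flow cannot outlast its timer. -/
theorem sub_le_timer_of_isSolution (hφ : (closedLoop 𝒢 a σ T₁ T₂ μ h γ).IsSolution φ) {j : ℕ}
    {r b : ℝ} (hrb : r ≤ b) (hsub : Icc r b ⊆ slice φ.dom j)
    (h0 : φ.val r j ∈ stateSpace n T₂) : b - r ≤ (φ.val r j).timer := by
  by_contra! hlt
  have hτ := h0.2.1
  -- At this interior time the timer would be negative.
  set t := r + ((φ.val r j).timer + (b - r)) / 2 with ht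
  have htm : t ∈ Ioo r b := ⟨by linarith, by linarith⟩
  have hint : t ∈ interior (slice φ.dom j) :=
    isOpen_Ioo.subset_interior_iff.2 (Ioo_subset_Icc_self.trans hsub) htm
  have h1 : 0 ≤ (φ.val t j).timer := (hφ.flow_mem j t hint).2.1
  rw [timer_eq_of_isSolution hφ hrb hsub t (Ioo_subset_Icc_self htm)] at h1
  linarith

theorem IsFlowCurve.mem_stateSpace {c : ℝ → State n} (hc : IsFlowCurve a σ μ h c)
    (ha : ∀ i, 0 ≤ a i) (h0 : c 0 ∈ stateSpace n T₂) {t : ℝ} (ht : 0 ≤ t)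
    (htτ : t ≤ (c 0).timer) : c t ∈ stateSpace n T₂ := by
  refine ⟨fun i => ?_, ?_⟩
  · rw [hc.τs_eq]
    exact add_nonneg (h0.1 i) (mul_nonneg ht (ha i))
  · rw [hc.timer_eq]
    exact ⟨by linarith, by linarith [h0.2.2]⟩

theorem mem_stateSpace_of_flow (hφ : (closedLoop 𝒢 a σ T₁ T₂ μ h γ).IsSolution φ)
    (ha : ∀ i, 0 ≤ a i) {j : ℕ} {r b : ℝ} (hrb : r ≤ b) (hsub : Icc r b ⊆ slice φ.dom j)
    (h0 : φ.val r j ∈ stateSpace n T₂) : ∀ t ∈ Icc r b, φ.val t j ∈ stateSpace n T₂ := by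
  obtain ⟨c, hc, hc0⟩ := exists_isFlowCurve a σ μ h (φ.val r j)
  intro t ht
  rw [eqOn_of_isSolution hφ hrb hsub hc hc0 t ht]
  refine hc.mem_stateSpace ha (hc0 ▸ h0) (by linarith [ht.1]) ?_
  rw [hc0]
  linarith [sub_le_timer_of_isSolution hφ hrb hsub h0, ht.2]

theorem mem_stateSpace_of_jump {x y : State n} (hT₁ : 0 < T₁)
    (hx : x ∈ (closedLoop 𝒢 a σ T₁ T₂ μ h γ).D) (hy : y ∈ (closedLoop 𝒢 a σ T₁ T₂ μ h γ).G x) :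
    y ∈ stateSpace n T₂ := by
  obtain ⟨ν, hν, rfl⟩ := hy
  exact ⟨fun i => hx.1.1 i, ⟨hT₁.le.trans hν.1, hν.2⟩⟩

theorem timer_jump {x y : State n} (hy : y ∈ (closedLoop 𝒢 a σ T₁ T₂ μ h γ).G x) :
    y.timer ∈ Icc T₁ T₂ := by
  obtain ⟨ν, hν, rfl⟩ := hy
  exact hν

/-- The switching times up to a hybrid time in the domain of a solution, with what the dynamics
says about them. -/
theorem exists_switching_times (hφ : (closedLoop 𝒢 a σ T₁ T₂ μ h γ).IsSolution φ)
    (hT₁ : 0 < T₁) {T : ℝ} {J : ℕ} (hTJ : (T, J) ∈ φ.dom) :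
    ∃ s : ℕ → ℝ, s 0 = 0 ∧ s (J + 1) = T ∧ (∀ j ≤ J, s j ≤ s (j + 1)) ∧
      (∀ j ≤ J, Icc (s j) (s (j + 1)) ⊆ slice φ.dom j) ∧
      (∀ j < J, φ.val (s (j + 1)) j ∈ (closedLoop 𝒢 a σ T₁ T₂ μ h γ).D ∧
        φ.val (s (j + 1)) (j + 1) ∈
          (closedLoop 𝒢 a σ T₁ T₂ μ h γ).G (φ.val (s (j + 1)) j)) ∧
      (∀ j ≤ J, φ.val (s j) j ∈ stateSpace n T₂) := by
  obtain ⟨_, _, H⟩ := isHybridTimeDomain_iff.1 φ.isHybridTimeDomain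
  obtain ⟨s, hs0, hsT, hle, hs⟩ := H T J hTJ
  have hsub : ∀ j ≤ J, Icc (s j) (s (j + 1)) ⊆ slice φ.dom j := fun j hj t ht =>
    ((hs j hj t).2 ht).1
  have hjump : ∀ j < J, φ.val (s (j + 1)) j ∈ (closedLoop 𝒢 a σ T₁ T₂ μ h γ).D ∧
      φ.val (s (j + 1)) (j + 1) ∈ (closedLoop 𝒢 a σ T₁ T₂ μ h γ).G (φ.val (s (j + 1)) j) :=
    fun j hj => hφ.jump _ _ (hsub j hj.le ⟨hle j hj.le, le_rfl⟩)
      (hsub (j + 1) hj ⟨le_rfl, hle (j + 1) hj⟩)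
  refine ⟨s, hs0, hsT, hle, hsub, hjump, ?_⟩
  rintro (_ | j) hj
  · rw [hs0]
    rcases hφ.init with h | h
    · exact (isClosed_stateSpace n T₂).closure_eq ▸ h
    · exact h.1
  · exact mem_stateSpace_of_jump hT₁ (hjump j hj).1 (hjump j hj).2

theorem mem_stateSpace_of_isSolution (hφ : (closedLoop 𝒢 a σ T₁ T₂ μ h γ).IsSolution φ)
    (ha : ∀ i, 0 ≤ a i) (hT₁ : 0 < T₁) {t : ℝ} {j : ℕ} (htj : (t, j) ∈ φ.dom) :
    φ.val t j ∈ stateSpace n T₂ := by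
  obtain ⟨s, -, hsT, hle, hsub, -, hmem⟩ := exists_switching_times hφ hT₁ htj
  refine mem_stateSpace_of_flow hφ ha (hle j le_rfl) (hsub j le_rfl) (hmem j le_rfl) t ?_
  exact ⟨hsT ▸ hle j le_rfl, hsT.ge⟩

/-! ### Maximal solutions are complete -/

/-- Slices are traversed in order of their index. This is not part of the definition of hybrid time
domains; it holds because a state at which a jump is possible admits no further flow. -/
theorem le_of_isSolution (hφ : (closedLoop 𝒢 a σ T₁ T₂ μ h γ).IsSolution φ) (hT₁ : 0 < T₁)
    {t t' : ℝ} {j j' : ℕ} (h : (t, j) ∈ φ.dom) (h' : (t', j') ∈ φ.dom)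
    (hjj' : j < j') : t ≤ t' := by
  obtain ⟨s, -, hsT, hle, hsub, hjump, -⟩ := exists_switching_times hφ hT₁ h'
  have hmono : ∀ k ≤ j' + 1, ∀ i ≤ k, s i ≤ s k := by
    intro k
    induction k with
    | zero => intro _ i hi; rw [Nat.le_zero.1 hi]
    | succ k ih =>
      intro hk i hi
      rcases hi.lt_or_eq with hi | rfl
      · exact (ih (by omega) i (by omega)).trans (hle k (by omega))
      · exact le_rfl
  have hst' : s (j + 1) ≤ t' := hsT ▸ hmono (j' + 1) le_rfl (j + 1) (by omega)
  by_contra! hlt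
  have hD := (hjump j hjj').1
  have hsj : (s (j + 1), j) ∈ φ.dom := hsub j hjj'.le ⟨hle j hjj'.le, le_rfl⟩
  have := sub_le_timer_of_isSolution hφ (hst'.trans hlt.le)
    (φ.isHybridTimeDomain.Icc_subset_slice hsj h) hD.1
  rw [hD.2] at this
  linarith

theorem isComplete_of_isMaximalSolution (ha : ∀ i, 0 ≤ a i) (hT₁ : 0 < T₁) (hT₂ : T₁ ≤ T₂)
    (hφ : (closedLoop 𝒢 a σ T₁ T₂ μ h γ).IsMaximalSolution φ) : φ.IsComplete := by
  intro hbdd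
  have hsol := hφ.1
  have hdom := φ.isHybridTimeDomain
  -- `J` is the index of the last slice, and `t₀` its starting time.
  obtain ⟨J, ⟨t, htJ⟩, htop⟩ : ∃ J, (∃ t, (t, J) ∈ φ.dom) ∧ ∀ p ∈ φ.dom, p.2 ≤ J := by
    obtain ⟨B, hB⟩ := hbdd.subset_closedBall ((0 : ℝ), (0 : ℕ))
    have hne : (Prod.snd '' φ.dom).Nonempty := ⟨0, _, hdom.zero_mem, rfl⟩
    have hub : BddAbove (Prod.snd '' φ.dom) := by
      refine ⟨⌈B⌉₊, ?_⟩
      rintro _ ⟨p, hp, rfl⟩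
      have h1 : dist p.2 0 ≤ B := (le_max_right _ _).trans (Metric.mem_closedBall.1 (hB hp))
      rw [Nat.dist_eq] at h1
      have h2 : (p.2 : ℝ) ≤ ⌈B⌉₊ := by
        refine le_trans ?_ (h1.trans (Nat.le_ceil B))
        simp
      exact_mod_cast h2
    obtain ⟨p, hp, hpJ⟩ := Nat.sSup_mem hne hub
    exact ⟨_, ⟨p.1, hpJ ▸ hp⟩, fun q hq => le_csSup hub ⟨q, hq, rfl⟩⟩
  obtain ⟨t₀, -, ht₀, hmin⟩ := hdom.exists_start htJ
  have hmem₀ := mem_stateSpace_of_isSolution hsol ha hT₁ ht₀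
  set τ₀ := (φ.val t₀ J).timer with hτ₀
  have hτ₀0 : 0 ≤ τ₀ := hmem₀.2.1
  obtain ⟨c, hc, hc0⟩ := exists_isFlowCurve a σ μ h (φ.val t₀ J)
  have hprev : ∀ p ∈ φ.dom, p.2 < J → p.1 ≤ t₀ := fun p hp hpJ =>
    le_of_isSolution hsol hT₁ (t := p.1) (j := p.2) hp ht₀ hpJ
  have hlast : ∀ r, (r, J) ∈ φ.dom → r ∈ Icc t₀ (t₀ + τ₀) := fun r hr => by
    have := sub_le_timer_of_isSolution hsol (hmin r hr) (hdom.Icc_subset_slice ht₀ hr) hmem₀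
    exact ⟨hmin r hr, by linarith⟩
  have hflow : ∀ r, (r, J) ∈ φ.dom → φ.val r J = c (r - t₀) := fun r hr =>
    eqOn_of_isSolution hsol (hmin r hr) (hdom.Icc_subset_slice ht₀ hr) hc hc0 r
      ⟨hmin r hr, le_rfl⟩
  have hcd := hc.comp_sub_const t₀
  have hcC : ContDiff ℝ 1 fun r => c (r - t₀) := by
    rw [contDiff_one_iff_deriv]
    refine ⟨fun r => (hcd r).differentiableAt, ?_⟩
    rw [show deriv (fun r => c (r - t₀)) = _ from funext fun r => (hcd r).deriv]
    exact ((flowLin n μ h).continuous.comp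
      (continuous_iff_continuousAt.2 fun r => (hcd r).continuousAt)).add continuous_const
  -- The last slice extends until the timer expires, and then a jump is possible.
  have hend : (t₀ + τ₀, J) ∈ φ.dom := by
    refine hφ.mem_dom_of_flow (le_add_of_nonneg_right hτ₀0) ht₀ hmin htop hprev
      (c := fun r => c (r - t₀)) hcC (fun r => ?_) (fun r hr => ?_) fun r hr =>
        ⟨(hlast r hr).2, hflow r hr⟩
    · rw [closedLoop_f]
      exact hcd r
    · exact hc.mem_stateSpace ha (hc0 ▸ hmem₀) (by linarith [hr.1]) (by rw [hc0]; linarith [hr.2])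
  have hval : φ.val (t₀ + τ₀) J ∈ (closedLoop 𝒢 a σ T₁ T₂ μ h γ).D := by
    refine ⟨mem_stateSpace_of_isSolution hsol ha hT₁ hend, ?_⟩
    rw [hflow _ hend, hc.timer_eq, hc0]
    ring
  have hne : ((closedLoop 𝒢 a σ T₁ T₂ μ h γ).G (φ.val (t₀ + τ₀) J)).Nonempty :=
    ⟨_, T₁, ⟨le_rfl, hT₂⟩, rfl⟩
  exact hne.ne_empty (hφ.jump_eq_empty hend htop hval)

end Solutions
end HyNTP

namespace HyNTP

open Matrix

/-! ### Exponential decay along solutions -/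

/-- Contraction between jumps, and bounded growth in between, give exponential decay in `t + j`,
because at most time `T₂` passes between jumps. -/
theorem exists_exponential_decay {n : ℕ} {𝒢 : Digraph (Fin n)} {a : Fin n → ℝ}
    {σ T₁ T₂ μ h γ : ℝ} (hT₁ : 0 < T₁) (hT₂ : T₁ ≤ T₂)
    {S W : State n → ℝ} (hS : ∀ x, 0 ≤ S x) {C₁ C₂ C₃ ρ : ℝ}
    (hC₁ : 0 < C₁) (hC₂ : 0 < C₂) (hC₃ : 0 < C₃) (hρ0 : 0 < ρ) (hρ1 : ρ < 1)
    (hflow : ∀ c, IsFlowCurve a σ μ h c → ∀ t ∈ Icc 0 T₂, S (c t) ≤ C₁ * S (c 0))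
    (hWS : ∀ x, W x ≤ C₂ * S x)
    (hSW : ∀ x, ∀ y ∈ (closedLoop 𝒢 a σ T₁ T₂ μ h γ).G x, S y ≤ C₃ * W x)
    (hW : ∀ x c, IsFlowCurve a σ μ h c → c 0 ∈ (closedLoop 𝒢 a σ T₁ T₂ μ h γ).G x →
      ∀ ν ∈ Icc T₁ T₂, W (c ν) ≤ ρ * W x) :
    ∃ κ > 0, ∃ α > 0, ∀ φ, (closedLoop 𝒢 a σ T₁ T₂ μ h γ).IsSolution φ →
      ∀ t j, (t, j) ∈ φ.dom → S (φ.val t j) ≤ κ * Real.exp (-α * (t + j)) * S (φ.val 0 0) := by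
  have hT₂0 : 0 < T₂ := hT₁.trans_le hT₂
  have hlog : Real.log ρ < 0 := Real.log_neg hρ0 hρ1
  set M := C₁ + C₁ * C₃ * C₂ * C₁ / ρ with hM
  have hM0 : 0 < M := by positivity
  refine ⟨M / ρ, by positivity, -Real.log ρ / (T₂ + 1), div_pos (by linarith) (by linarith),
    fun φ hφ T J hTJ => ?_⟩
  obtain ⟨s, hs0, hsT, hle, hsub, hjump, hmem⟩ := exists_switching_times hφ hT₁ hTJ
  have hlen : ∀ j ≤ J, s (j + 1) - s j ≤ (φ.val (s j) j).timer := fun j hj =>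
    sub_le_timer_of_isSolution hφ (hle j hj) (hsub j hj) (hmem j hj)
  have hlen' : ∀ j ≤ J, s (j + 1) - s j ≤ T₂ := fun j hj => (hlen j hj).trans (hmem j hj).2.2
  have hseg : ∀ j ≤ J, S (φ.val (s (j + 1)) j) ≤ C₁ * S (φ.val (s j) j) := fun j hj => by
    obtain ⟨c, hc, hc0⟩ := exists_isFlowCurve a σ μ h (φ.val (s j) j)
    rw [eqOn_of_isSolution hφ (hle j hj) (hsub j hj) hc hc0 _ ⟨hle j hj, le_rfl⟩, ← hc0]
    exact hflow c hc _ ⟨by linarith [hle j hj], hlen' j hj⟩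
  set S₀ := S (φ.val 0 0) with hS₀
  have hS₀0 : 0 ≤ S₀ := hS _
  have hdecay : ∀ j < J, W (φ.val (s (j + 1)) j) ≤ ρ ^ j * (C₂ * (C₁ * S₀)) := by
    intro j
    induction j with
    | zero =>
      intro hj
      rw [pow_zero, one_mul]
      have := hseg 0 hj.le
      rw [hs0] at this
      exact (hWS _).trans (mul_le_mul_of_nonneg_left this hC₂.le)
    | succ j ih =>
      intro hj
      obtain ⟨c, hc, hc0⟩ := exists_isFlowCurve a σ μ h (φ.val (s (j + 1)) (j + 1))
      obtain ⟨hD, hG⟩ := hjump j (by omega)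
      -- The next jump occurs exactly when the timer has run down to zero.
      have hν : s (j + 1 + 1) - s (j + 1) = (φ.val (s (j + 1)) (j + 1)).timer := by
        have h1 := timer_eq_of_isSolution hφ (hle (j + 1) hj.le) (hsub (j + 1) hj.le) _
          ⟨hle (j + 1) hj.le, le_rfl⟩
        rw [(hjump (j + 1) hj).1.2] at h1
        linarith
      rw [eqOn_of_isSolution hφ (hle _ hj.le) (hsub _ hj.le) hc hc0 _ ⟨hle _ hj.le, le_rfl⟩]
      refine (hW _ c hc (hc0 ▸ hG) _ (hν ▸ timer_jump hG)).trans ?_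
      rw [pow_succ', mul_assoc]
      exact mul_le_mul_of_nonneg_left (ih (by omega)) hρ0.le
  have hmain : S (φ.val T J) ≤ M * ρ ^ J * S₀ := by
    have hpow : 0 < ρ ^ J := pow_pos hρ0 J
    have hlast := hseg J le_rfl
    rw [hsT] at hlast
    rcases J with _ | J
    · rw [hs0] at hlast
      refine hlast.trans ?_
      rw [pow_zero, mul_one]
      refine mul_le_mul_of_nonneg_right ?_ hS₀0
      rw [hM]
      exact le_add_of_nonneg_right (by positivity)
    · calc S (φ.val T (J + 1)) ≤ C₁ * (C₃ * (ρ ^ J * (C₂ * (C₁ * S₀)))) :=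
            hlast.trans (mul_le_mul_of_nonneg_left ((hSW _ _ (hjump J J.lt_succ_self).2).trans
              (mul_le_mul_of_nonneg_left (hdecay J J.lt_succ_self) hC₃.le)) hC₁.le)
        _ = C₁ * C₃ * C₂ * C₁ / ρ * ρ ^ (J + 1) * S₀ := by field_simp; ring
        _ ≤ M * ρ ^ (J + 1) * S₀ := by
          gcongr
          rw [hM]
          exact le_add_of_nonneg_left hC₁.le
  have hT : T ≤ T₂ * (J + 1) := by
    have : ∀ j ≤ J + 1, s j ≤ T₂ * j := by
      intro j
      induction j with
      | zero => intro _; simp [hs0]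
      | succ j ih =>
        intro hj
        have := hlen' j (by omega)
        have := ih (by omega)
        push_cast
        linarith
    have := this (J + 1) le_rfl
    rw [hsT] at this
    exact_mod_cast this
  have hexp : ρ ^ J ≤ Real.exp (-(-Real.log ρ / (T₂ + 1)) * (T + J)) / ρ := by
    rw [le_div_iff₀ hρ0, ← pow_succ, ← Real.exp_log (pow_pos hρ0 (J + 1)), Real.log_pow]
    refine Real.exp_le_exp.2 ?_
    have h1 : T + J ≤ (T₂ + 1) * (J + 1) := by linarith
    have h2 : -(-Real.log ρ / (T₂ + 1)) * (T + J) = Real.log ρ * ((T + J) / (T₂ + 1)) := by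
      field_simp
    have h3 : (T + J) / (T₂ + 1) ≤ (J : ℝ) + 1 := by
      rw [div_le_iff₀ (by linarith)]
      linarith
    rw [h2]
    push_cast
    nlinarith
  refine hmain.trans (mul_le_mul_of_nonneg_right ?_ hS₀0)
  calc M * ρ ^ J ≤ M * (Real.exp (-(-Real.log ρ / (T₂ + 1)) * (T + J)) / ρ) := by gcongr
    _ = _ := by ring

end HyNTP

end

theorem theorem1 (m : ℕ) (𝒢 : Digraph (Fin (m + 1))) (h𝒢 : 𝒢.IsStronglyConnected)
    (a : Fin (m + 1) → ℝ) (ha : ∀ i, 0 ≤ a i) (σ : ℝ)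
    (T : Matrix (Fin (m + 1)) (Fin (m + 1)) ℝ) (Lbar : Matrix (Fin m) (Fin m) ℝ)
    (hT : HyNTP.IsBlockForm 𝒢.laplacian T Lbar)
    (T₁ T₂ μ h γ : ℝ) (hT₁ : 0 < T₁) (hT₂ : T₁ ≤ T₂) (hμ : 0 < μ) (hγ : 0 < γ)
    (P₁ : Matrix (Fin m ⊕ Fin m) (Fin m ⊕ Fin m) ℝ) (P₂ : Matrix (Fin 2) (Fin 2) ℝ)
    (P₃ : Matrix (Fin m ⊕ Fin m) (Fin m ⊕ Fin m) ℝ)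
    (hP₁ : P₁.PosDef) (hP₂ : P₂.PosDef) (hP₃ : P₃.PosDef)
    (hLyap₂ : (-(P₂ * HyNTP.Af3 μ + (HyNTP.Af3 μ).transpose * P₂)).PosDef)
    (hLyap₃ : (-(P₃ * HyNTP.Af4 m μ + (HyNTP.Af4 m μ).transpose * P₃)).PosDef)
    (hJump : ∀ ν ∈ Set.Icc T₁ T₂, (-(HyNTP.jumpQ h γ Lbar P₁ ν)).PosDef)
    (ε β₁ β₂ κ₂ : ℝ) (hε : 0 < ε) (hβ₁ : 0 < β₁) (hβ₂ : 0 < β₂)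
    (hLyapβ₁ : (-(β₁ • (1 : Matrix (Fin 2) (Fin 2) ℝ)) -
      (P₂ * HyNTP.Af3 μ + (HyNTP.Af3 μ).transpose * P₂)).PosSemidef)
    (hLyapβ₂ : (-(β₂ • (1 : Matrix (Fin m ⊕ Fin m) (Fin m ⊕ Fin m) ℝ)) -
      (P₃ * HyNTP.Af4 m μ + (HyNTP.Af4 m μ).transpose * P₃)).PosSemidef)
    (hκ₂ : κ₂ ∈ Set.Ioo 0 (HyNTP.kappa2Bound h γ T₁ T₂ Lbar P₁))
    (hScalar : |Real.exp (HyNTP.kappaBar1 h T₂ ε β₂ P₁ / HyNTP.alpha2 h T₂ P₁ P₂ P₃ * T₂) *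
      (1 - min 1 κ₂ / HyNTP.alpha2 h T₂ P₁ P₂ P₃)| < 1) :
    (HyNTP.closedLoop 𝒢 a σ T₁ T₂ μ h γ).GloballyExponentiallyStable (HyNTP.syncSet a σ T₂) := by
  have hT₂0 : 0 ≤ T₂ := hT₁.le.trans hT₂
  obtain ⟨R, U, hRL, hUL, hR, hU⟩ := hT.exists_factorization
  obtain ⟨C₀, hC₀, hdist⟩ := HyNTP.exists_infDist_le_errSize hU a σ T₂
  obtain ⟨C₄, hC₄, hsize⟩ := HyNTP.exists_errSize_le_infDist hR a σ hT₂0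
  obtain ⟨C₁, hC₁, hflow⟩ := HyNTP.exists_errSize_flow_le R a σ h T₂ hμ
  obtain ⟨W, ⟨C₂, hC₂, hWS⟩, ⟨C₃, hC₃, hSW⟩, ρ, hρ0, hρ1, hW⟩ :=
    HyNTP.exists_lyapunov (a := a) (σ := σ) hRL hUL hT₁ hμ hP₁ hP₂ hJump hβ₁ hLyapβ₁
  obtain ⟨κ, hκ, α, hα, hexp⟩ := HyNTP.exists_exponential_decay hT₁ hT₂
    (HyNTP.errSize_nonneg R a σ) hC₁ hC₂ hC₃ hρ0 hρ1 hflow hWS hSW hW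
  refine ⟨HyNTP.isClosed_syncSet a σ T₂, HyNTP.syncSet_nonempty a σ hT₂0, C₀ * κ * C₄,
    by positivity, α, hα, fun φ hφ => ⟨HyNTP.isComplete_of_isMaximalSolution ha hT₁ hT₂ hφ,
      fun t j htj => ?_⟩⟩
  calc _ ≤ C₀ * HyNTP.errSize R a σ (φ.val t j) :=
        hdist _ (HyNTP.mem_stateSpace_of_isSolution hφ.1 ha hT₁ htj)
    _ ≤ C₀ * (κ * Real.exp (-α * (t + j)) * HyNTP.errSize R a σ (φ.val 0 0)) := by
        have := hexp φ hφ.1 t j htj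
        gcongr
    _ ≤ C₀ * (κ * Real.exp (-α * (t + j)) *
          (C₄ * Metric.infDist (φ.val 0 0) (HyNTP.syncSet a σ T₂))) := by
        have := hsize (φ.val 0 0)
        gcongr
    _ = _ := by ring
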